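/- Let $\mathbb{K}$ be a field and let $A=\mathbb{K}[x_1,\dots,x_n]$ carry a positive $\mathbb{Z}^m$-grading: the degree of every variable is a nonzero vector of $\mathbb{Z}^m$ whose first nonzero component is positive, and the rows of the $m\times n$ matrix whose columns are the degrees of the variables are linearly independent. Let $\mathfrak{m}=(x_1,\dots,x_n)$. Let $T=(\mathbb{K}^\times)^r$ be a torus. All actions of $T$ are $\mathbb{K}$-linear and algebraic, i.e. for every vector $v$ and every linear functional $f$ the function $\tau\mapsto f(\tau\cdot v)$ on $T$ is a Laurent polynomial function. Given an action of $T$ on $A$ and on a graded $A$-module $M$, the latter is compatible if $\tau\cdot M_d\subseteq M_d$ and $\tau\cdot(am)=(\tau\cdot a)(\tau\cdot m)$ for all $\tau\in T$, $d\in\mathbb{Z}^m$, $a\in A$, $m\in M$. Fix an action of $T$ on $A$ that is compatible in this sense for $M=A$. For a finite dimensional $\mathbb{Z}^m$-graded representation $V$ of $T$ (each graded component being $T$-stable), the free $A$-module $V\otimes_{\mathbb{K}}A$ is given the grading $(V\otimes A)_d=\bigoplus_{d'+d''=d}V_{d'}\otimes A_{d''}$ and the diagonal action of $T$. A minimal free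 resolution of a finitely generated graded $A$-module $M$ is an exact complex $\cdots\to F_2\xrightarrow{d_2}F_1\xrightarrow{d_1}F_0\xrightarrow{d_0}M\to0$ of $A$-linear degree preserving maps, in which every $F_i$ is a finitely generated graded free $A$-module (i.e. it has a finite homogeneous basis) and $d_i(F_i)\subseteq\mathfrak{m}F_{i-1}$ for all $i\ge1$. Let $M$ be a finitely generated $\mathbb{Z}^m$-graded $A$-module with a compatible action of $T$. Then: 1. There are finite dimensional $\mathbb{Z}^m$-graded representations $V_0,\dots,V_n$ of $T$ and a minimal free resolution $$0\to F_n\xrightarrow{d_n}F_{n-1}\to\cdots\to F_1\xrightarrow{d_1}F_0\xrightarrow{d_0}M\to0,\qquad F_i=V_i\otimes_{\mathbb{K}}A,$$ of $M$ such that the action of $T$ on each $F_i$ is compatible and all the maps $d_0,d_1,\dots,d_n$ are $T$-equivariant. 2. For every minimal free resolution $(F_\bullet,d_\bullet)$ of the graded $A$-module $M$ there are compatible actions of $T$ on all the $F_i$ such that all the maps $d_i$, $i\ge0$, are $T$-equivariant; moreover each $F_i$ is then isomorphic, by a $T$-equivariant isomorphism of graded $A$-modules, to $V\otimes_{\mathbb{K}}A$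 for some finite dimensional $\mathbb{Z}^m$-graded representation $V$ of $T$. -/

import Mathlib

open scoped TensorProduct

namespace EquivariantResolution

universe u v w

/-- The group `T = Kˣ × ⋯ × Kˣ` (`r` factors) of points of a split torus over `K`. -/
abbrev Torus (K : Type u) [Field K] (r : ℕ) : Type u := Fin r → Kˣ

/-- The polynomial ring `A = K[x₁, …, xₙ]`. -/
abbrev PolyRing (K : Type u) [Field K] (n : ℕ) : Type u := MvPolynomial (Fin n) K

/-- Regular functions on the torus: polynomials in the coordinates `τⱼ` and their inverses. -/
def IsRegularFunction {K : Type u} [Field K] {r : ℕ} (f : Torus K r → K) : Prop :=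
  ∃ p : MvPolynomial (Fin r ⊕ Fin r) K, ∀ τ : Torus K r,
    f τ = MvPolynomial.eval
      (Sum.elim (fun j => ((τ j : Kˣ) : K)) (fun j => (((τ j)⁻¹ : Kˣ) : K))) p

/-- A linear action of the torus is algebraic if all its matrix coefficients
`τ ↦ f (τ • v)` are regular functions on the torus. -/
def IsAlgebraicAction {K : Type u} [Field K] {r : ℕ} {V : Type v} [AddCommGroup V] [Module K V]
    (ρ : Representation K (Torus K r) V) : Prop :=
  ∀ (x : V) (f : Module.Dual K V), IsRegularFunction (fun τ => f (ρ τ x))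

/-- A positive `ℤᵐ`-grading of `K[x₁, …, xₙ]`, where `wt i` is the degree of `xᵢ`: every `wt i` is
nonzero and its first nonzero component is positive, and the rows of the `m × n` matrix whose
columns are the degrees of the variables are linearly independent. -/
structure IsPositiveGrading {n m : ℕ} (wt : Fin n → Fin m → ℤ) : Prop where
  first_pos : ∀ i, ∃ k, 0 < wt i k ∧ ∀ j < k, wt i j = 0
  rows_independent : LinearIndependent ℤ (fun (k : Fin m) (i : Fin n) => wt i k)

/-- The homogeneous component `A_d` of the polynomial ring. -/
noncomputable abbrev polyGrading (K : Type u) [Field K] {n m : ℕ} (wt : Fin n → Fin m → ℤ) :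
    (Fin m → ℤ) → Submodule K (PolyRing K n) :=
  MvPolynomial.weightedHomogeneousSubmodule K wt

/-- The ideal `𝔪 = (x₁, …, xₙ)`. -/
noncomputable def irrelevantIdeal (K : Type u) [Field K] (n : ℕ) : Ideal (PolyRing K n) :=
  Ideal.span (Set.range MvPolynomial.X)

/-- `(M, ℳ)` is a finitely generated graded `A`-module. -/
structure IsFGGraded {K : Type u} [Field K] {n m : ℕ} (wt : Fin n → Fin m → ℤ)
    {M : Type v} [AddCommGroup M] [Module K M] [Module (PolyRing K n) M]
    (ℳ : (Fin m → ℤ) → Submodule K M) : Prop where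
  finite : Module.Finite (PolyRing K n) M
  isInternal : DirectSum.IsInternal ℳ
  smul_mem : ∀ (d d' : Fin m → ℤ) (a : PolyRing K n) (x : M),
    a ∈ polyGrading K wt d → x ∈ ℳ d' → a • x ∈ ℳ (d + d')

/-- The action `ρ` on the graded module `(M, ℳ)` is algebraic and compatible with the grading and
with multiplication (with respect to the action `ρA` on `A`). -/
structure IsCompatibleAction {K : Type u} [Field K] {n m r : ℕ}
    (ρA : Representation K (Torus K r) (PolyRing K n))
    {M : Type v} [AddCommGroup M] [Module K M] [Module (PolyRing K n) M]
    (ℳ : (Fin m → ℤ) → Submodule K M) (ρ : Representation K (Torus K r) M) : Prop where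
  algebraic : IsAlgebraicAction ρ
  map_mem : ∀ (τ : Torus K r) (d : Fin m → ℤ) (x : M), x ∈ ℳ d → ρ τ x ∈ ℳ d
  map_smul : ∀ (τ : Torus K r) (a : PolyRing K n) (x : M), ρ τ (a • x) = ρA τ a • ρ τ x

/-- A `K`-linear (in practice `A`-linear) map between graded modules preserving degrees. -/
def PreservesDegree {K : Type u} [Field K] {m : ℕ} {M : Type v} {N : Type w}
    [AddCommGroup M] [Module K M] [AddCommGroup N] [Module K N]
    (ℳ : (Fin m → ℤ) → Submodule K M) (𝒩 : (Fin m → ℤ) → Submodule K N) (f : M → N) : Prop :=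
  ∀ (d : Fin m → ℤ) (x : M), x ∈ ℳ d → f x ∈ 𝒩 d

/-- Equivariance of a map between two representations. -/
def IsEquivariant {K : Type u} [Field K] {r : ℕ} {M : Type v} {N : Type w}
    [AddCommGroup M] [Module K M] [AddCommGroup N] [Module K N]
    (ρ : Representation K (Torus K r) M) (σ : Representation K (Torus K r) N) (f : M → N) : Prop :=
  ∀ (τ : Torus K r) (x : M), f (ρ τ x) = σ τ (f x)

/-- A finite dimensional `ℤᵐ`-graded (algebraic) representation of the torus. -/
structure GradedRep (K : Type u) [Field K] (r m : ℕ) where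
  V : Type u
  [addCommGroup : AddCommGroup V]
  [module : Module K V]
  [finite : Module.Finite K V]
  grading : (Fin m → ℤ) → Submodule K V
  isInternal : DirectSum.IsInternal grading
  ρ : Representation K (Torus K r) V
  algebraic : IsAlgebraicAction ρ
  map_mem : ∀ (τ : Torus K r) (d : Fin m → ℤ) (x : V), x ∈ grading d → ρ τ x ∈ grading d

attribute [instance] GradedRep.addCommGroup GradedRep.module GradedRep.finite

namespace GradedRep

/-- The `A`-module `V ⊗ A`. The factors are written in the order `A ⊗ V`, so that Mathlib's
`A`-module structure on the tensor product is `a • (b ⊗ v) = (a * b) ⊗ v`. -/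
abbrev Free {K : Type u} [Field K] {r m : ℕ} (V : GradedRep K r m) (n : ℕ) : Type u :=
  PolyRing K n ⊗[K] V.V

/-- `(V ⊗ A)_d = ⨁_{d' + d'' = d} A_{d'} ⊗ V_{d''}`. -/
noncomputable def freeGrading {K : Type u} [Field K] {r m n : ℕ} (V : GradedRep K r m)
    (wt : Fin n → Fin m → ℤ) (d : Fin m → ℤ) : Submodule K (V.Free n) :=
  Submodule.span K {z | ∃ d' d'' : Fin m → ℤ, d' + d'' = d ∧
    ∃ a ∈ polyGrading K wt d', ∃ v ∈ V.grading d'', z = a ⊗ₜ[K] v}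

/-- The diagonal action `τ • (a ⊗ v) = (τ • a) ⊗ (τ • v)`. -/
noncomputable def freeAction {K : Type u} [Field K] {r m n : ℕ} (V : GradedRep K r m)
    (ρA : Representation K (Torus K r) (PolyRing K n)) : Representation K (Torus K r) (V.Free n) :=
  ρA.tprod V.ρ

end GradedRep

/-- The complex `⋯ → F 2 → F 1 → F 0 → M → 0`, with differentials `d i : F (i + 1) → F i` and
augmentation `ε`, is a minimal (graded) free resolution of the graded `A`-module `M`: each `F i`
is a finitely generated graded module with a homogeneous basis, all maps preserve degrees, the
complex is exact, and each differential `d i` has image in `𝔪 F i`. -/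
structure IsMinimalFreeResolution {K : Type u} [Field K] {n m : ℕ} (wt : Fin n → Fin m → ℤ)
    {M : Type v} [AddCommGroup M] [Module K M] [Module (PolyRing K n) M]
    (ℳ : (Fin m → ℤ) → Submodule K M)
    {F : ℕ → Type w} [∀ i, AddCommGroup (F i)] [∀ i, Module K (F i)] [∀ i, Module (PolyRing K n) (F i)]
    (ℱ : ∀ i, (Fin m → ℤ) → Submodule K (F i))
    (d : ∀ i, F (i + 1) →ₗ[PolyRing K n] F i) (ε : F 0 →ₗ[PolyRing K n] M) : Prop where
  graded : ∀ i, IsFGGraded wt (ℱ i)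
  free : ∀ i, ∃ (s : ℕ) (b : Module.Basis (Fin s) (PolyRing K n) (F i)), ∀ j, ∃ e, b j ∈ ℱ i e
  d_degree : ∀ i, PreservesDegree (ℱ (i + 1)) (ℱ i) (d i)
  ε_degree : PreservesDegree (ℱ 0) ℳ ε
  ε_surjective : Function.Surjective ε
  exact_zero : Function.Exact (d 0) ε
  exact_succ : ∀ i, Function.Exact (d (i + 1)) (d i)
  minimal : ∀ i, LinearMap.range (d i) ≤ irrelevantIdeal K n • (⊤ : Submodule (PolyRing K n) (F i))

/-- The graded module `(F, ℱ)` with torus action `ρ` is an equivariantly free module: it is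
isomorphic, by an `A`-linear, degree preserving and equivariant isomorphism, to `V ⊗ A` for a
finite dimensional graded representation `V`. -/
def IsEquivariantlyFree {K : Type u} [Field K] {n m r : ℕ} (wt : Fin n → Fin m → ℤ)
    (ρA : Representation K (Torus K r) (PolyRing K n))
    {F : Type w} [AddCommGroup F] [Module K F] [Module (PolyRing K n) F]
    (ℱ : (Fin m → ℤ) → Submodule K F) (ρ : Representation K (Torus K r) F) : Prop :=
  ∃ (V : GradedRep K r m) (e : V.Free n ≃ₗ[PolyRing K n] F),
    PreservesDegree (V.freeGrading wt) ℱ e ∧ PreservesDegree ℱ (V.freeGrading wt) e.symm ∧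
    IsEquivariant (V.freeAction ρA) ρ e

end EquivariantResolution

open EquivariantResolution

/-! Everything rests on minimal covers. Positivity gives A_0 = K, so each component of a finitely
generated graded module is finite dimensional, and a homogeneous submodule N with N + 𝔪M = M is all
of M (`IsFGGraded.eq_top_of_le_sup`). An algebraic torus action on a finite dimensional space is
diagonalizable (`IsAlgebraicAction.span_eigenvectors`, by independence of characters), so M is
spanned by homogeneous eigenvectors. Some of these map to a basis of M/𝔪M; their span carries a
representation V, and V ⊗ A → M is an equivariant surjection with kernel in 𝔪(V ⊗ A)
(`IsCompatibleAction.exists_minimal_cover`).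

The kernel is again graded, stable and, A being Noetherian, finitely generated. Iterating gives a
minimal equivariant resolution. Its length is at most n because a free resolution stays exact in
homological degrees above k once x₁, …, x_k are set to zero (`exists_sub_mem_initialIdeal_smul`).
For k = n, minimality makes all differentials vanish, so F_i = 𝔪F_i for i > n.

For an arbitrary minimal resolution, any two minimal graded free covers of a module are isomorphic
over it (`exists_equiv_of_minimal_covers`). Each F_i therefore receives the action of some V ⊗ A by
transport. Working up the resolution, the action on F_i restricts to the image of d_i : F_{i+1} →
F_i, which F_{i+1} covers minimally. -/

namespace EquivariantResolution

universe u v w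

/-! ### Homogeneous components in graded vector spaces -/

section Components

variable {K : Type*} [Field K] {ι : Type*} [DecidableEq ι]
  {M : Type*} [AddCommGroup M] [Module K M] {N : Type*} [AddCommGroup N] [Module K N]

/-- The decomposition of the elements of a graded vector space into homogeneous components. -/
noncomputable def componentMap {ℳ : ι → Submodule K M} (h : DirectSum.IsInternal ℳ) :
    M →ₗ[K] ι →₀ M :=
  DirectSum.toModule K ι (ι →₀ M) (fun d => Finsupp.lsingle d ∘ₗ (ℳ d).subtype) ∘ₗ
    (LinearEquiv.ofBijective (DirectSum.coeLinearMap ℳ) h).symm.toLinearMap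

theorem componentMap_of_mem {ℳ : ι → Submodule K M} (h : DirectSum.IsInternal ℳ) {d : ι} {x : M}
    (hx : x ∈ ℳ d) : componentMap h x = Finsupp.single d x := by
  have : (LinearEquiv.ofBijective (DirectSum.coeLinearMap ℳ) h).symm x =
      DirectSum.lof K ι (fun d => ℳ d) d ⟨x, hx⟩ := by
    rw [LinearEquiv.symm_apply_eq]
    exact (DirectSum.coeLinearMap_lof ℳ d ⟨x, hx⟩).symm
  simp only [componentMap, LinearMap.comp_apply, LinearEquiv.coe_coe, this,
    DirectSum.toModule_lof]
  simp

/-- Induction on homogeneous elements of a graded vector space. -/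
theorem homogeneous_induction {ℳ : ι → Submodule K M} (h : DirectSum.IsInternal ℳ) {p : M → Prop}
    (mem : ∀ d, ∀ x ∈ ℳ d, p x) (zero : p 0) (add : ∀ x y, p x → p y → p (x + y)) (x : M) : p x :=
  Submodule.iSup_induction ℳ (motive := p) (h.submodule_iSup_eq_top ▸ Submodule.mem_top : x ∈ iSup ℳ)
    mem zero add

theorem componentMap_mem {ℳ : ι → Submodule K M} (h : DirectSum.IsInternal ℳ) (x : M) (d : ι) :
    componentMap h x d ∈ ℳ d := by
  induction x using homogeneous_induction h with
  | mem e x hx =>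
    rw [componentMap_of_mem h hx, Finsupp.single_apply]
    split_ifs with hed
    · exact hed ▸ hx
    · exact zero_mem _
  | zero => simp
  | add x y hx hy => simpa using add_mem hx hy

theorem componentMap_sum {ℳ : ι → Submodule K M} (h : DirectSum.IsInternal ℳ) (x : M) :
    ((componentMap h x).sum fun _ y => y) = x := by
  induction x using homogeneous_induction h with
  | mem e x hx => simp [componentMap_of_mem h hx]
  | zero => simp
  | add x y hx hy =>
    rw [map_add, Finsupp.sum_add_index' (fun _ => rfl) (fun _ _ _ => rfl), hx, hy]

theorem mem_of_componentMap_mem {ℳ : ι → Submodule K M} (h : DirectSum.IsInternal ℳ)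
    {S : Type*} [SetLike S M] [AddSubmonoidClass S M] (s : S) {x : M}
    (hx : ∀ d, componentMap h x d ∈ s) : x ∈ s := by
  rw [← componentMap_sum h x]
  exact sum_mem fun d _ => hx d

/-- A family of subspaces is a grading as soon as it spans and the elements of the subspaces can
be separated by a linear map. -/
theorem isInternal_of_componentMap {ℳ : ι → Submodule K M} (htop : iSup ℳ = ⊤)
    (δ : M →ₗ[K] ι →₀ M) (hδ : ∀ d, ∀ x ∈ ℳ d, δ x = Finsupp.single d x) :
    DirectSum.IsInternal ℳ := by
  refine DirectSum.isInternal_submodule_of_iSupIndep_of_iSup_eq_top (fun d => ?_) htop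
  rw [Submodule.disjoint_def]
  intro x hx hx'
  have h1 : δ x d = x := by rw [hδ d x hx, Finsupp.single_eq_same]
  have h2 : (⨆ j, ⨆ (_ : j ≠ d), ℳ j) ≤ LinearMap.ker (Finsupp.lapply d ∘ₗ δ) := by
    refine iSup₂_le fun j hj y hy => ?_
    simp [hδ j y hy, hj]
  rw [← h1]
  exact h2 hx'

theorem componentMap_map {ℳ : ι → Submodule K M} {𝒩 : ι → Submodule K N}
    (hM : DirectSum.IsInternal ℳ) (hN : DirectSum.IsInternal 𝒩) (f : M →ₗ[K] N)
    (hf : ∀ d, ∀ x ∈ ℳ d, f x ∈ 𝒩 d) (x : M) (d : ι) :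
    componentMap hN (f x) d = f (componentMap hM x d) := by
  induction x using homogeneous_induction hM with
  | mem e x hx =>
    rw [componentMap_of_mem hM hx, componentMap_of_mem hN (hf e x hx), Finsupp.single_apply,
      Finsupp.single_apply]
    split_ifs <;> simp
  | zero => simp
  | add x y hx hy => simp [hx, hy]

theorem mem_iff_componentMap_eq {ℳ : ι → Submodule K M} (h : DirectSum.IsInternal ℳ) {x : M}
    {d : ι} : x ∈ ℳ d ↔ componentMap h x d = x :=
  ⟨fun hx => by rw [componentMap_of_mem h hx, Finsupp.single_eq_same],
    fun hx => hx ▸ componentMap_mem h x d⟩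

/-- The grading induced on a homogeneous subspace. -/
theorem isInternal_comap_subtype {ℳ : ι → Submodule K M} (h : DirectSum.IsInternal ℳ)
    {L : Submodule K M} (hL : ∀ x ∈ L, ∀ d, componentMap h x d ∈ L) :
    DirectSum.IsInternal (fun d => (ℳ d).comap L.subtype) := by
  refine DirectSum.isInternal_submodule_of_iSupIndep_of_iSup_eq_top (fun d => ?_) ?_
  · rw [Submodule.disjoint_def]
    intro x hx hx'
    have h1 : (⨆ j, ⨆ (_ : j ≠ d), (ℳ j).comap L.subtype) ≤
        (⨆ j, ⨆ (_ : j ≠ d), ℳ j).comap L.subtype :=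
      iSup₂_le fun j hj => Submodule.comap_mono (le_iSup₂_of_le j hj le_rfl)
    exact Subtype.ext ((Submodule.disjoint_def.1 (h.submodule_iSupIndep d)) x hx (h1 hx'))
  · rw [eq_top_iff]
    intro x _
    have : x = ∑ d ∈ (componentMap h (x : M)).support,
        (⟨componentMap h (x : M) d, hL x x.2 d⟩ : L) := by
      ext
      rw [AddSubmonoidClass.coe_finsetSum]
      exact (componentMap_sum h (x : M)).symm
    rw [this]
    exact sum_mem fun d _ => Submodule.mem_iSup_of_mem d (componentMap_mem h (x : M) d)

end Components

/-! ### Positive gradings of the polynomial ring -/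

section Positivity

variable {K : Type u} [Field K] {n m : ℕ} {wt : Fin n → Fin m → ℤ}

/-- This is what yields A_0 = K. Among the variables occurring in the monomial, take one whose first
positive coordinate k comes earliest: in coordinate k every occurring variable contributes a
nonnegative amount, and this one a positive amount. -/
theorem IsPositiveGrading.eq_zero_of_weight_eq_zero (hwt : IsPositiveGrading wt) (s : Fin n →₀ ℕ)
    (hs : Finsupp.weight wt s = 0) : s = 0 := by
  choose k hk hk' using hwt.first_pos
  by_contra hne
  obtain ⟨i, hi, hmin⟩ := s.support.exists_min_image k (Finsupp.support_nonempty_iff.2 hne)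
  have h := congrFun hs (k i)
  rw [Finsupp.weight_apply, Finsupp.sum, Finset.sum_apply] at h
  simp only [Pi.smul_apply, Pi.zero_apply, nsmul_eq_mul] at h
  have hnn : ∀ j ∈ s.support, 0 ≤ (s j : ℤ) * wt j (k i) := by
    intro j hj
    rcases (hmin j hj).lt_or_eq with hlt | heq
    · simp [hk' j _ hlt]
    · rw [heq]
      exact mul_nonneg (Int.natCast_nonneg _) (hk j).le
  have h0 := (Finset.sum_eq_zero_iff_of_nonneg hnn).1 h i hi
  have := hk i
  rcases mul_eq_zero.1 h0 with h1 | h1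
  · exact (Finsupp.mem_support_iff.1 hi) (by exact_mod_cast h1)
  · omega

theorem isInternal_polyGrading (K : Type u) [Field K] (wt : Fin n → Fin m → ℤ) :
    DirectSum.IsInternal (polyGrading K wt) :=
  letI := MvPolynomial.weightedDecomposition K wt
  DirectSum.Decomposition.isInternal _

theorem IsPositiveGrading.eq_C_of_mem_zero (hwt : IsPositiveGrading wt) {a : PolyRing K n}
    (ha : a ∈ polyGrading K wt 0) : a = MvPolynomial.C (MvPolynomial.constantCoeff a) := by
  ext s
  rw [MvPolynomial.coeff_C]
  split_ifs with h
  · rw [← h, MvPolynomial.constantCoeff_eq]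
  · by_contra hne
    exact h (hwt.eq_zero_of_weight_eq_zero s (ha hne)).symm

theorem constantCoeff_eq_zero_of_mem_ne_zero {a : PolyRing K n} {d : Fin m → ℤ} (hd : d ≠ 0)
    (ha : a ∈ polyGrading K wt d) : MvPolynomial.constantCoeff a = 0 := by
  by_contra hne
  exact hd (by simpa using (ha (d := 0) hne).symm)

theorem IsPositiveGrading.componentMap_zero (hwt : IsPositiveGrading wt) (a : PolyRing K n) :
    componentMap (isInternal_polyGrading K wt) a 0 =
      MvPolynomial.C (MvPolynomial.constantCoeff a) := by
  induction a using homogeneous_induction (isInternal_polyGrading K wt) with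
  | mem d a ha =>
    rw [componentMap_of_mem _ ha, Finsupp.single_apply]
    split_ifs with h
    · subst h
      exact hwt.eq_C_of_mem_zero ha
    · rw [constantCoeff_eq_zero_of_mem_ne_zero h ha, map_zero]
  | zero => simp
  | add a b ha hb => simp [ha, hb]

theorem mem_irrelevantIdeal_iff {a : PolyRing K n} :
    a ∈ irrelevantIdeal K n ↔ MvPolynomial.constantCoeff a = 0 := by
  rw [irrelevantIdeal, ← Set.image_univ, MvPolynomial.mem_ideal_span_X_image,
    MvPolynomial.constantCoeff_eq]
  constructor
  · intro h
    by_contra hne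
    obtain ⟨i, -, hi⟩ := h 0 (MvPolynomial.mem_support_iff.2 hne)
    exact hi rfl
  · intro h s hs
    obtain ⟨i, hi⟩ : ∃ i, s i ≠ 0 := by
      by_contra! hall
      rw [Finsupp.ext hall (g := 0)] at hs
      exact MvPolynomial.mem_support_iff.1 hs h
    exact ⟨i, trivial, hi⟩

end Positivity

/-! ### Nakayama's lemma and finite dimensionality of graded pieces -/

section GradedModules

variable {K : Type u} [Field K] {n m : ℕ} {wt : Fin n → Fin m → ℤ}
  {M : Type v} [AddCommGroup M] [Module K M] [Module (PolyRing K n) M] {ℳ : (Fin m → ℤ) → Submodule K M}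

theorem IsFGGraded.componentMap_smul (hM : IsFGGraded wt ℳ) {e : Fin m → ℤ} {x : M}
    (hx : x ∈ ℳ e) (a : PolyRing K n) (d : Fin m → ℤ) :
    componentMap hM.isInternal (a • x) (d + e) =
      componentMap (isInternal_polyGrading K wt) a d • x := by
  induction a using homogeneous_induction (isInternal_polyGrading K wt) with
  | mem d' a ha =>
    rw [componentMap_of_mem _ ha, componentMap_of_mem _ (hM.smul_mem d' e a x ha hx),
      Finsupp.single_apply, Finsupp.single_apply]
    by_cases h : d' = d <;> simp [h]
  | zero => simp
  | add a b ha hb => simp [add_smul, ha, hb]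

variable [IsScalarTower K (PolyRing K n) M]

/-- Only the degree zero part of a keeps x in its own degree, and that part is a scalar. -/
theorem IsFGGraded.componentMap_smul_self (hM : IsFGGraded wt ℳ) (hwt : IsPositiveGrading wt)
    {e : Fin m → ℤ} {x : M} (hx : x ∈ ℳ e) (a : PolyRing K n) :
    componentMap hM.isInternal (a • x) e = MvPolynomial.constantCoeff a • x := by
  have := hM.componentMap_smul hx a 0
  rw [zero_add, hwt.componentMap_zero] at this
  rw [this, ← MvPolynomial.algebraMap_eq, algebraMap_smul]

/-- Graded Nakayama lemma. -/
theorem IsFGGraded.eq_top_of_le_sup (hM : IsFGGraded wt ℳ) (hwt : IsPositiveGrading wt)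
    {N : Submodule (PolyRing K n) M} (hN : ∀ x ∈ N, ∀ d, componentMap hM.isInternal x d ∈ N)
    (h : N ⊔ irrelevantIdeal K n • ⊤ = ⊤) : N = ⊤ := by
  have := hM.finite
  have hQ : (⊤ : Submodule (PolyRing K n) (M ⧸ N)) ≤
      irrelevantIdeal K n • (⊤ : Submodule (PolyRing K n) (M ⧸ N)) := by
    have h1 := congrArg (Submodule.map N.mkQ) h
    rw [Submodule.map_sup, Submodule.map_smul'', Submodule.map_top, Submodule.range_mkQ,
      Submodule.mkQ_map_self, bot_sup_eq] at h1
    exact h1.ge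
  -- The ungraded Nakayama lemma gives a ≡ 1 mod 𝔪 killing M/N. For homogeneous y of degree d, the
  -- degree d part of a • y is y itself, so homogeneity of N forces y ∈ N. No bound on the degrees
  -- occurring in M is needed.
  obtain ⟨a, ha, ha'⟩ := Submodule.exists_sub_one_mem_and_smul_eq_zero_of_fg_of_le_smul _ _
    Module.Finite.fg_top hQ
  have ha0 : MvPolynomial.constantCoeff a = 1 := by
    rw [mem_irrelevantIdeal_iff, map_sub, map_one, sub_eq_zero] at ha
    exact ha
  rw [eq_top_iff]
  intro x _
  refine mem_of_componentMap_mem hM.isInternal N fun d => ?_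
  have hx := componentMap_mem hM.isInternal x d
  have h2 : a • componentMap hM.isInternal x d ∈ N := by
    rw [← Submodule.Quotient.mk_eq_zero, Submodule.Quotient.mk_smul]
    exact ha' _ trivial
  have h3 := hN _ h2 d
  rwa [hM.componentMap_smul_self hwt hx, ha0, one_smul] at h3

/-- A subspace W of ℳ d is recovered as the degree d part of A·W. Hence W ↦ A·W is strictly
monotone, and ascending chains in ℳ d stop because M is Noetherian. -/
theorem IsFGGraded.finiteDimensional (hM : IsFGGraded wt ℳ) (hwt : IsPositiveGrading wt)
    (d : Fin m → ℤ) : Module.Finite K (ℳ d) := by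
  have := hM.finite
  have hnoeth : IsNoetherian (PolyRing K n) M := inferInstance
  let φ : Submodule K (ℳ d) → Submodule (PolyRing K n) M :=
    fun W => Submodule.span _ (W.map (ℳ d).subtype : Set M)
  have hφ : ∀ (W : Submodule K (ℳ d)) (x : ℳ d), (x : M) ∈ φ W → x ∈ W := by
    intro W x hx
    have key : ∀ y ∈ φ W, componentMap hM.isInternal y d ∈ W.map (ℳ d).subtype := by
      intro y hy
      induction hy using Submodule.closure_induction with
      | zero => simp
      | add y z _ _ hy hz => simpa using add_mem hy hz
      | smul_mem a y hy =>
        obtain ⟨y, hy, rfl⟩ := hy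
        rw [hM.componentMap_smul_self hwt (by simp)]
        exact Submodule.smul_mem _ _ ⟨y, hy, rfl⟩
    have h1 := key _ hx
    rw [componentMap_of_mem _ x.2, Finsupp.single_eq_same] at h1
    obtain ⟨y, hy, hyx⟩ := h1
    rwa [← Subtype.ext hyx]
  have hmono : StrictMono φ := by
    refine Monotone.strictMono_of_injective
      (fun W W' h => Submodule.span_mono (Set.image_mono h)) fun W W' h => ?_
    refine le_antisymm (fun x hx => hφ _ _ ?_) (fun x hx => hφ _ _ ?_)
    · rw [← h]; exact Submodule.subset_span ⟨x, hx, rfl⟩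
    · rw [h]; exact Submodule.subset_span ⟨x, hx, rfl⟩
  have : WellFoundedGT (Submodule (PolyRing K n) M) := inferInstance
  have : IsNoetherian K (ℳ d) := isNoetherian_iff'.2 hmono.wellFoundedGT
  infer_instance

end GradedModules

/-! ### Regular functions as combinations of characters -/

section RegularFunctions

variable {K : Type u} [Field K] {r : ℕ}

theorem IsRegularFunction.add {f g : Torus K r → K} (hf : IsRegularFunction f)
    (hg : IsRegularFunction g) : IsRegularFunction (fun τ => f τ + g τ) := by
  obtain ⟨p, hp⟩ := hf
  obtain ⟨q, hq⟩ := hg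
  exact ⟨p + q, fun τ => by simp only [hp, hq, map_add]⟩

theorem IsRegularFunction.mul {f g : Torus K r → K} (hf : IsRegularFunction f)
    (hg : IsRegularFunction g) : IsRegularFunction (fun τ => f τ * g τ) := by
  obtain ⟨p, hp⟩ := hf
  obtain ⟨q, hq⟩ := hg
  exact ⟨p * q, fun τ => by simp only [hp, hq, map_mul]⟩

theorem isRegularFunction_zero : IsRegularFunction (fun _ : Torus K r => (0 : K)) :=
  ⟨0, fun _ => by rw [map_zero]⟩

theorem isRegularFunction_sum {ι : Type*} (s : Finset ι) (f : ι → Torus K r → K)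
    (hf : ∀ i ∈ s, IsRegularFunction (f i)) : IsRegularFunction (fun τ => ∑ i ∈ s, f i τ) := by
  classical
  induction s using Finset.induction_on with
  | empty => simpa using isRegularFunction_zero
  | insert i s hi ih =>
    simp only [Finset.sum_insert hi]
    exact (hf i (Finset.mem_insert_self i s)).add
      (ih fun j hj => hf j (Finset.mem_insert_of_mem hj))

/-- The coordinates of the torus and their inverses, as characters. -/
def coordinateCharacter (K : Type u) [Field K] (r : ℕ) : Fin r ⊕ Fin r → Torus K r →* K :=
  Sum.elim (fun j => (Units.coeHom K).comp (Pi.evalMonoidHom _ j))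
    (fun j => (Units.coeHom K).comp (invMonoidHom.comp (Pi.evalMonoidHom _ j)))

/-- Laurent monomials are multiplicative. Characters are treated as functions on the group of
points, so monomials that coincide over a finite field cause no trouble. -/
theorem IsRegularFunction.mem_span {f : Torus K r → K} (hf : IsRegularFunction f) :
    f ∈ Submodule.span K (Set.range fun χ : Torus K r →* K => (χ : Torus K r → K)) := by
  obtain ⟨p, hp⟩ := hf
  have : f = ∑ s ∈ p.support, p.coeff s •
      ((∏ j, coordinateCharacter K r j ^ s j : Torus K r →* K) : Torus K r → K) := by
    ext τ
    rw [hp, MvPolynomial.eval_eq', Finset.sum_apply]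
    refine Finset.sum_congr rfl fun s _ => ?_
    rw [Pi.smul_apply, smul_eq_mul, MonoidHom.finsetProd_apply]
    congr 1
    refine Finset.prod_congr rfl fun j _ => ?_
    rcases j with j | j <;> rfl
  rw [this]
  exact sum_mem fun s _ => Submodule.smul_mem _ _ (Submodule.subset_span ⟨_, rfl⟩)

end RegularFunctions

/-! ### Diagonalizability of torus representations -/

section Eigenvectors

variable {K : Type u} [Field K] {r : ℕ} {V : Type v} [AddCommGroup V] [Module K V]

/-- The restriction of a representation to a stable subspace. -/
def restrictRepresentation (ρ : Representation K (Torus K r) V) (L : Submodule K V)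
    (hL : ∀ τ, ∀ x ∈ L, ρ τ x ∈ L) : Representation K (Torus K r) L where
  toFun τ := (ρ τ).restrict (hL τ)
  map_one' := by ext; simp
  map_mul' σ τ := by ext; simp

theorem IsAlgebraicAction.restrict {ρ : Representation K (Torus K r) V} (hρ : IsAlgebraicAction ρ)
    (L : Submodule K V) (hL : ∀ τ, ∀ x ∈ L, ρ τ x ∈ L) :
    IsAlgebraicAction (restrictRepresentation ρ L hL) := by
  intro x f
  obtain ⟨g, rfl⟩ := f.exists_extend
  exact hρ x g

/-- Every finite dimensional representation of a split torus is spanned by eigenvectors. -/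
theorem IsAlgebraicAction.span_eigenvectors [Module.Finite K V]
    {ρ : Representation K (Torus K r) V} (hρ : IsAlgebraicAction ρ) :
    Submodule.span K {x : V | ∀ τ, ∃ c : K, ρ τ x = c • x} = ⊤ := by
  classical
  rw [eq_top_iff]
  intro x _
  let b := Module.finBasis K V
  -- Each coordinate of τ • x is a combination of characters of τ; `y χ` collects the coefficients
  -- of χ, so that τ • x = ∑ χ(τ) y_χ.
  choose c hc using fun i =>
    (Finsupp.mem_span_range_iff_exists_finsupp.1 (hρ x (b.coord i)).mem_span)
  let S : Finset (Torus K r →* K) := Finset.univ.biUnion fun i => (c i).support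
  let y : (Torus K r →* K) → V := fun χ => ∑ i, c i χ • b i
  have hy : ∀ τ, ρ τ x = ∑ χ ∈ S, χ τ • y χ := by
    intro τ
    simp only [y, Finset.smul_sum]
    rw [Finset.sum_comm, ← b.sum_repr (ρ τ x)]
    refine Finset.sum_congr rfl fun i _ => ?_
    have h1 := congrFun (hc i) τ
    simp only [Module.Basis.coord_apply] at h1
    rw [← h1, Finsupp.sum_of_support_subset (s := S) _
      (Finset.subset_biUnion_of_mem (fun i => (c i).support) (Finset.mem_univ i)) _ (by simp),
      Finset.sum_apply, Finset.sum_smul]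
    refine Finset.sum_congr rfl fun χ _ => ?_
    rw [Pi.smul_apply, smul_eq_mul, smul_smul, mul_comm]
  have heig : ∀ χ ∈ S, ∀ σ, ρ σ (y χ) = χ σ • y χ := by
    intro χ hχ σ
    refine b.ext_elem fun i => ?_
    -- Expand σ • (τ • x) = (στ) • x and compare the coefficients of χ(τ), as functions of τ, using
    -- Dedekind's independence of characters.
    have hlin := linearIndependent_iff'.1 (linearIndependent_monoidHom (Torus K r) K) S
      (fun χ => b.repr (ρ σ (y χ)) i - b.repr (χ σ • y χ) i) ?_ χ hχ
    · exact sub_eq_zero.1 hlin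
    · ext τ
      have h1 : ρ σ (ρ τ x) = ρ (σ * τ) x := by rw [map_mul]; rfl
      rw [hy, hy, map_sum] at h1
      have h2 := congrArg (fun z => b.repr z i) h1
      simp only [map_sum, map_smul, Finsupp.finsetSum_apply, Finsupp.smul_apply, smul_eq_mul,
        map_mul] at h2
      rw [Finset.sum_apply, Pi.zero_apply, ← sub_eq_zero.2 h2, ← Finset.sum_sub_distrib]
      refine Finset.sum_congr rfl fun χ _ => ?_
      simp only [Pi.smul_apply, smul_eq_mul, map_smul, Finsupp.smul_apply]
      ring
  have hx : x = ∑ χ ∈ S, y χ := by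
    -- Every character takes the value 1 at the identity.
    have := hy 1
    simpa using this
  rw [hx]
  exact sum_mem fun χ hχ => Submodule.subset_span fun τ => ⟨χ τ, heig χ hχ τ⟩

end Eigenvectors

/-! ### Compatible actions on graded modules and submodules -/

section CompatibleActions

variable {K : Type u} [Field K] {n m r : ℕ} {wt : Fin n → Fin m → ℤ}
  {ρA : Representation K (Torus K r) (PolyRing K n)}
  {M : Type v} [AddCommGroup M] [Module K M] [Module (PolyRing K n) M]
  [IsScalarTower K (PolyRing K n) M] {ℳ : (Fin m → ℤ) → Submodule K M}
  {ρ : Representation K (Torus K r) M}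

/-- M itself may be infinite dimensional, so diagonalization is applied to each stable, finite
dimensional component. -/
theorem IsCompatibleAction.span_homogeneous_eigenvectors (hρ : IsCompatibleAction ρA ℳ ρ)
    (hM : IsFGGraded wt ℳ) (hwt : IsPositiveGrading wt) :
    Submodule.span K {x : M | (∃ d, x ∈ ℳ d) ∧ ∀ τ, ∃ c : K, ρ τ x = c • x} = ⊤ := by
  rw [eq_top_iff, ← hM.isInternal.submodule_iSup_eq_top]
  refine iSup_le fun d => ?_
  have := hM.finiteDimensional hwt d
  have h := (hρ.algebraic.restrict (ℳ d) fun τ x hx => hρ.map_mem τ d x hx).span_eigenvectors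
  calc ℳ d = (⊤ : Submodule K (ℳ d)).map (ℳ d).subtype := by simp
    _ ≤ _ := by
      rw [← h, Submodule.map_span, Submodule.span_le]
      rintro _ ⟨x, hx, rfl⟩
      refine Submodule.subset_span ⟨⟨d, x.2⟩, fun τ => ?_⟩
      obtain ⟨c, hc⟩ := hx τ
      exact ⟨c, congrArg Subtype.val hc⟩

/-- A homogeneous submodule of a finitely generated graded module. -/
theorem IsFGGraded.submodule (hM : IsFGGraded wt ℳ) {N : Submodule (PolyRing K n) M}
    (hN : ∀ x ∈ N, ∀ d, componentMap hM.isInternal x d ∈ N) :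
    IsFGGraded wt (fun d => (ℳ d).comap (N.restrictScalars K).subtype) where
  finite := by
    have := hM.finite
    exact inferInstanceAs (Module.Finite (PolyRing K n) N)
  isInternal := isInternal_comap_subtype hM.isInternal hN
  smul_mem d d' a x ha hx := hM.smul_mem d d' a x ha hx

theorem IsCompatibleAction.submodule (hρ : IsCompatibleAction ρA ℳ ρ)
    {N : Submodule (PolyRing K n) M} (hN : ∀ τ, ∀ x ∈ N, ρ τ x ∈ N) :
    IsCompatibleAction ρA (fun d => (ℳ d).comap (N.restrictScalars K).subtype)
      (restrictRepresentation ρ (N.restrictScalars K) hN) where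
  algebraic := hρ.algebraic.restrict _ _
  map_mem τ d x hx := hρ.map_mem τ d x hx
  map_smul τ a x := Subtype.ext (hρ.map_smul τ a x)

end CompatibleActions

/-! ### The equivariant free module V ⊗ A -/

namespace GradedRep

variable {K : Type u} [Field K] {r m n : ℕ} (V : GradedRep K r m) {wt : Fin n → Fin m → ℤ}

theorem tmul_mem_freeGrading {d e : Fin m → ℤ} {a : PolyRing K n} {x : V.V}
    (ha : a ∈ polyGrading K wt d) (hx : x ∈ V.grading e) :
    (a ⊗ₜ[K] x : V.Free n) ∈ V.freeGrading wt (d + e) :=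
  Submodule.subset_span ⟨d, e, rfl, a, ha, x, hx, rfl⟩

theorem iSup_freeGrading : ⨆ d, V.freeGrading (n := n) wt d = ⊤ := by
  rw [Submodule.eq_top_iff']
  intro z
  induction z using TensorProduct.induction_on with
  | zero => exact zero_mem _
  | add x y hx hy => exact add_mem hx hy
  | tmul a x =>
    induction a using homogeneous_induction (isInternal_polyGrading K wt) with
    | zero => rw [TensorProduct.zero_tmul]; exact zero_mem _
    | add a b ha hb => rw [TensorProduct.add_tmul]; exact add_mem ha hb
    | mem d a ha =>
      induction x using homogeneous_induction V.isInternal with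
      | zero => rw [TensorProduct.tmul_zero]; exact zero_mem _
      | add x y hx hy => rw [TensorProduct.tmul_add]; exact add_mem hx hy
      | mem e x hx => exact Submodule.mem_iSup_of_mem _ (V.tmul_mem_freeGrading ha hx)

theorem isInternal_freeGrading (wt : Fin n → Fin m → ℤ) :
    DirectSum.IsInternal (V.freeGrading (n := n) wt) := by
  -- The separating map takes components in both factors, giving a bigraded decomposition, and then
  -- adds the two degrees.
  refine isInternal_of_componentMap V.iSup_freeGrading
    (Finsupp.lmapDomain _ K (fun p : (Fin m → ℤ) × (Fin m → ℤ) => p.1 + p.2) ∘ₗ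
      (finsuppTensorFinsupp K K (PolyRing K n) V.V (Fin m → ℤ) (Fin m → ℤ)).toLinearMap ∘ₗ
      TensorProduct.map (componentMap (isInternal_polyGrading K wt))
        (componentMap V.isInternal)) fun d z hz => ?_
  induction hz using Submodule.span_induction with
  | zero => simp
  | add x y _ _ hx hy => rw [map_add, hx, hy, Finsupp.single_add]
  | smul c x _ hx => rw [map_smul, hx, Finsupp.smul_single]
  | mem z hz =>
    obtain ⟨d', d'', rfl, a, ha, x, hx, rfl⟩ := hz
    simp [componentMap_of_mem _ ha, componentMap_of_mem _ hx]

theorem isFGGraded_freeGrading (wt : Fin n → Fin m → ℤ) :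
    IsFGGraded wt (V.freeGrading (n := n) wt) where
  finite := inferInstance
  isInternal := V.isInternal_freeGrading wt
  smul_mem d d' a z ha hz := by
    induction hz using Submodule.span_induction with
    | zero => rw [smul_zero]; exact zero_mem _
    | add x y _ _ hx hy => rw [smul_add]; exact add_mem hx hy
    | smul c x _ hx => rw [smul_comm]; exact Submodule.smul_mem _ _ hx
    | mem z hz =>
      obtain ⟨e, e', rfl, b, hb, x, hx, rfl⟩ := hz
      rw [TensorProduct.smul_tmul', smul_eq_mul, ← add_assoc]
      exact V.tmul_mem_freeGrading (MvPolynomial.IsWeightedHomogeneous.mul ha hb) hx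

theorem freeAction_tmul (ρA : Representation K (Torus K r) (PolyRing K n)) (τ : Torus K r)
    (a : PolyRing K n) (x : V.V) : V.freeAction ρA τ (a ⊗ₜ x) = ρA τ a ⊗ₜ V.ρ τ x := rfl

theorem isCompatibleAction_freeAction {ρA : Representation K (Torus K r) (PolyRing K n)}
    (hA : IsCompatibleAction ρA (polyGrading K wt) ρA) :
    IsCompatibleAction ρA (V.freeGrading wt) (V.freeAction ρA) where
  algebraic z f := by
    induction z using TensorProduct.induction_on with
    | zero => simpa using isRegularFunction_zero
    | add x y hx hy => simpa using hx.add hy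
    | tmul a x =>
      -- Expanding τ • x in a basis of V writes the matrix coefficient as a finite sum of products
      -- of a coefficient of V and one of A.
      let b := Module.finBasis K V.V
      have h : ∀ τ, f (V.freeAction ρA τ (a ⊗ₜ x)) =
          ∑ i, b.coord i (V.ρ τ x) * f (ρA τ a ⊗ₜ b i) := by
        intro τ
        rw [freeAction_tmul]
        conv_lhs => rw [← b.sum_repr (V.ρ τ x)]
        rw [TensorProduct.tmul_sum, map_sum]
        refine Finset.sum_congr rfl fun i _ => ?_
        rw [TensorProduct.tmul_smul, map_smul, smul_eq_mul, b.coord_apply]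
      simp only [h]
      exact isRegularFunction_sum _ _ fun i _ => (V.algebraic x (b.coord i)).mul
        (hA.algebraic a (f ∘ₗ (TensorProduct.mk K (PolyRing K n) V.V).flip (b i)))
  map_mem τ d z hz := by
    induction hz using Submodule.span_induction with
    | zero => rw [map_zero]; exact zero_mem _
    | add x y _ _ hx hy => rw [map_add]; exact add_mem hx hy
    | smul c x _ hx => rw [map_smul]; exact Submodule.smul_mem _ _ hx
    | mem z hz =>
      obtain ⟨e, e', rfl, b, hb, x, hx, rfl⟩ := hz
      exact V.tmul_mem_freeGrading (hA.map_mem τ e b hb) (V.map_mem τ e' x hx)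
  map_smul τ a z := by
    induction z using TensorProduct.induction_on with
    | zero => simp
    | add x y hx hy => simp only [smul_add, map_add, hx, hy]
    | tmul b x =>
      rw [TensorProduct.smul_tmul', freeAction_tmul, freeAction_tmul, TensorProduct.smul_tmul',
        smul_eq_mul, smul_eq_mul]
      exact congrArg (· ⊗ₜ[K] V.ρ τ x) (hA.map_smul τ a b)

theorem exists_homogeneous_basis (wt : Fin n → Fin m → ℤ) :
    ∃ (s : ℕ) (b : Module.Basis (Fin s) (PolyRing K n) (V.Free n)),
      ∀ j, ∃ e, b j ∈ V.freeGrading wt e := by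
  let b := V.isInternal.collectedBasis fun d => Module.Free.chooseBasis K (V.grading d)
  -- The index type runs over all degrees; it is finite only because it indexes a basis of the
  -- finite dimensional V.
  have : Finite ((d : Fin m → ℤ) × Module.Free.ChooseBasisIndex K (V.grading d)) :=
    Module.Finite.finite_basis b
  obtain ⟨s, ⟨e⟩⟩ := Finite.exists_equiv_fin
    ((d : Fin m → ℤ) × Module.Free.ChooseBasisIndex K (V.grading d))
  refine ⟨s, (b.baseChange (PolyRing K n)).reindex e, fun j => ⟨0 + (e.symm j).1, ?_⟩⟩
  rw [Module.Basis.reindex_apply, Module.Basis.baseChange_apply]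
  exact V.tmul_mem_freeGrading (MvPolynomial.isWeightedHomogeneous_one K wt)
    (V.isInternal.collectedBasis_mem _ _)

/-- The projection `V ⊗ A → V ⊗ A / 𝔪 = V`. -/
noncomputable def residue (n : ℕ) : V.Free n →ₗ[K] V.V :=
  (TensorProduct.lid K V.V).toLinearMap ∘ₗ
    LinearMap.rTensor V.V (MvPolynomial.aeval (fun _ : Fin n => (0 : K))).toLinearMap

theorem residue_tmul (a : PolyRing K n) (x : V.V) :
    V.residue n (a ⊗ₜ x) = MvPolynomial.constantCoeff a • x := by
  simp [residue, MvPolynomial.constantCoeff]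

theorem residue_smul (a : PolyRing K n) (z : V.Free n) :
    V.residue n (a • z) = MvPolynomial.constantCoeff a • V.residue n z := by
  induction z using TensorProduct.induction_on with
  | zero => simp
  | add x y hx hy => simp only [smul_add, map_add, hx, hy]
  | tmul b x =>
    rw [TensorProduct.smul_tmul', residue_tmul, residue_tmul, smul_eq_mul, map_mul, mul_smul]

theorem residue_eq_zero {z : V.Free n}
    (hz : z ∈ irrelevantIdeal K n • (⊤ : Submodule (PolyRing K n) (V.Free n))) :
    V.residue n z = 0 := by
  induction hz using Submodule.smul_induction_on' with
  | smul a ha z _ => rw [residue_smul, mem_irrelevantIdeal_iff.1 ha, zero_smul]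
  | add x _ y _ hx hy => rw [map_add, hx, hy, add_zero]

/-- Together with `residue_eq_zero` this identifies (V ⊗ A)/𝔪(V ⊗ A) with V: modulo 𝔪, each
polynomial is its constant term. -/
theorem sub_residue_mem (z : V.Free n) : z - 1 ⊗ₜ V.residue n z ∈
    irrelevantIdeal K n • (⊤ : Submodule (PolyRing K n) (V.Free n)) := by
  induction z using TensorProduct.induction_on with
  | zero => simp
  | add x y hx hy =>
    rw [map_add, TensorProduct.tmul_add, add_sub_add_comm]
    exact add_mem hx hy
  | tmul a x =>
    have : (a ⊗ₜ x - 1 ⊗ₜ V.residue n (a ⊗ₜ x) : V.Free n) =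
        (a - MvPolynomial.C (MvPolynomial.constantCoeff a)) • (1 ⊗ₜ x) := by
      rw [residue_tmul, TensorProduct.smul_tmul', smul_eq_mul, mul_one, TensorProduct.sub_tmul,
        ← TensorProduct.smul_tmul, MvPolynomial.smul_eq_C_mul, mul_one]
    rw [this]
    exact Submodule.smul_mem_smul (mem_irrelevantIdeal_iff.2 (by simp)) trivial

/-- A sum of characters, with a basis of eigenvectors of prescribed degrees. -/
noncomputable def ofCharacters {s : ℕ} (deg : Fin s → Fin m → ℤ) (χ : Fin s → Torus K r →* K)
    (hχ : ∀ j, IsRegularFunction (χ j)) : GradedRep K r m where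
  V := Fin s → K
  grading d := ⨅ j, ⨅ (_ : deg j ≠ d), LinearMap.ker (LinearMap.proj j)
  isInternal := by
    refine isInternal_of_componentMap ?_
      (∑ j, Finsupp.lsingle (deg j) ∘ₗ LinearMap.single K _ j ∘ₗ LinearMap.proj j) ?_
    · rw [eq_top_iff]
      intro x _
      rw [← Finset.univ_sum_single x]
      refine sum_mem fun j _ => Submodule.mem_iSup_of_mem (deg j) ?_
      simp only [Submodule.mem_iInf, LinearMap.mem_ker, LinearMap.proj_apply]
      intro i hi
      exact Pi.single_eq_of_ne (fun h => hi (congrArg deg h)) _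
    · intro d x hx
      simp only [Submodule.mem_iInf, LinearMap.mem_ker, LinearMap.proj_apply] at hx
      rw [LinearMap.sum_apply]
      conv_rhs => rw [← Finset.univ_sum_single x]
      rw [Finsupp.single_finsetSum]
      refine Finset.sum_congr rfl fun j _ => ?_
      simp only [LinearMap.comp_apply, LinearMap.proj_apply, Finsupp.lsingle_apply,
        LinearMap.single_apply]
      by_cases h : deg j = d
      · rw [h]
      · simp [hx j h]
  ρ :=
    { toFun τ := LinearMap.pi fun j => χ j τ • LinearMap.proj j
      map_one' := by ext; simp
      map_mul' σ τ := by
        refine LinearMap.ext fun x => funext fun j => ?_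
        simp [mul_assoc] }
  algebraic x f := by
    have h : ∀ τ : Torus K r, f (fun j => χ j τ * x j) = ∑ j, χ j τ * (x j * f (Pi.single j 1)) := by
      intro τ
      conv_lhs => rw [LinearMap.pi_apply_eq_sum_univ f]
      refine Finset.sum_congr rfl fun j _ => ?_
      rw [smul_eq_mul, mul_assoc]
      congr 3
      ext i
      simp [Pi.single_apply, eq_comm]
    have hconst : ∀ c : K, IsRegularFunction (fun _ : Torus K r => c) := fun c =>
      ⟨MvPolynomial.C c, fun _ => by simp⟩
    have := isRegularFunction_sum Finset.univ (fun j τ => χ j τ * (x j * f (Pi.single j 1)))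
      fun j _ => (hχ j).mul (hconst _)
    simp only [← h] at this
    exact this
  map_mem τ d x hx := by
    simp only [Submodule.mem_iInf, LinearMap.mem_ker, LinearMap.proj_apply] at hx ⊢
    intro j hj
    simp [hx j hj]

/-- Keeps the carrier `Fin s → K` behind an equivalence, so that later arguments use only the
coordinates. -/
theorem exists_of_characters {s : ℕ} (deg : Fin s → Fin m → ℤ) {χ : Fin s → Torus K r →* K}
    (hχ : ∀ j, IsRegularFunction (χ j)) :
    ∃ (V : GradedRep K r m) (e : V.V ≃ₗ[K] (Fin s → K)),
      (∀ d, ∀ x ∈ V.grading d, ∀ j, deg j ≠ d → e x j = 0) ∧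
      ∀ τ x j, e (V.ρ τ x) j = χ j τ * e x j := by
  let V := ofCharacters deg χ hχ
  let e : V.V ≃ₗ[K] (Fin s → K) :=
    { toFun := fun x => x
      invFun := fun x => x
      map_add' := fun _ _ => rfl
      map_smul' := fun _ _ => rfl
      left_inv := fun _ => rfl
      right_inv := fun _ => rfl }
  refine ⟨V, e, fun d (x : Fin s → K) hx j hj => ?_, fun τ x j => rfl⟩
  have hx' : x ∈ (⨅ j, ⨅ (_ : deg j ≠ d), LinearMap.ker (LinearMap.proj j) :
    Submodule K (Fin s → K)) := hx
  simp only [Submodule.mem_iInf, LinearMap.mem_ker, LinearMap.proj_apply] at hx'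
  exact hx' j hj

end GradedRep

/-! ### Kernels and images are homogeneous and stable -/

section Kernels

theorem IsEquivariant.map_mem_ker {K : Type u} [Field K] {n r : ℕ}
    {M : Type*} [AddCommGroup M] [Module K M] [Module (PolyRing K n) M]
    {P : Type*} [AddCommGroup P] [Module K P] [Module (PolyRing K n) P]
    {ρ : Representation K (Torus K r) P}
    {σ : Representation K (Torus K r) M} {f : P →ₗ[PolyRing K n] M}
    (hf : IsEquivariant ρ σ f) :
    ∀ τ, ∀ x ∈ LinearMap.ker f, ρ τ x ∈ LinearMap.ker f := by
  intro τ x hx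
  rw [LinearMap.mem_ker, hf, LinearMap.mem_ker.1 hx, map_zero]

variable {K : Type u} [Field K] {n m : ℕ} {wt : Fin n → Fin m → ℤ}
  {M : Type*} [AddCommGroup M] [Module K M] [Module (PolyRing K n) M]
  [IsScalarTower K (PolyRing K n) M] {ℳ : (Fin m → ℤ) → Submodule K M}
  {P : Type*} [AddCommGroup P] [Module K P] [Module (PolyRing K n) P]
  [IsScalarTower K (PolyRing K n) P] {𝒢 : (Fin m → ℤ) → Submodule K P}

theorem componentMap_mem_ker (hM : IsFGGraded wt ℳ) (hP : IsFGGraded wt 𝒢)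
    {f : P →ₗ[PolyRing K n] M} (hf : PreservesDegree 𝒢 ℳ f) :
    ∀ x ∈ LinearMap.ker f, ∀ d, componentMap hP.isInternal x d ∈ LinearMap.ker f := by
  intro x hx d
  have := componentMap_map hP.isInternal hM.isInternal (f.restrictScalars K) hf x d
  rw [LinearMap.restrictScalars_apply, LinearMap.restrictScalars_apply, LinearMap.mem_ker.1 hx,
    map_zero] at this
  exact this.symm

theorem componentMap_mem_range (hM : IsFGGraded wt ℳ) (hP : IsFGGraded wt 𝒢)
    {f : P →ₗ[PolyRing K n] M} (hf : PreservesDegree 𝒢 ℳ f) :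
    ∀ x ∈ LinearMap.range f, ∀ d, componentMap hM.isInternal x d ∈ LinearMap.range f := by
  rintro _ ⟨x, rfl⟩ d
  exact ⟨_, (componentMap_map hP.isInternal hM.isInternal (f.restrictScalars K) hf x d).symm⟩

end Kernels

/-! ### Representations built from eigenvectors -/

section LinearAlgebra

variable {K : Type u} [Field K] {r : ℕ} {M : Type v} [AddCommGroup M] [Module K M]

/-- A spanning set contains representatives of a basis of every finite dimensional quotient. -/
theorem exists_basis_image_of_span_eq_top {Q : Type*} [AddCommGroup Q] [Module K Q]
    [Module.Finite K Q] {S : Set M} (hS : Submodule.span K S = ⊤) (q : M →ₗ[K] Q)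
    (hq : Function.Surjective q) :
    ∃ (s : ℕ) (y : Fin s → M), (∀ j, y j ∈ S) ∧ LinearIndependent K (q ∘ y) ∧
      Submodule.span K (Set.range (q ∘ y)) = ⊤ := by
  have hqS : Submodule.span K (Set.range fun x : S => q x) = ⊤ := by
    have : (Set.range fun x : S => q x) = q '' S := by ext; simp
    rw [this, Submodule.span_image, hS, Submodule.map_top, LinearMap.range_eq_top.2 hq]
  obtain ⟨κ, a, -, hspan, hlin⟩ := exists_linearIndependent' K fun x : S => q x
  have : Finite κ := hlin.finite
  obtain ⟨s, ⟨e⟩⟩ := Finite.exists_equiv_fin κ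
  refine ⟨s, fun j => a (e.symm j), fun j => (a (e.symm j)).2,
    hlin.comp e.symm e.symm.injective, ?_⟩
  rw [← hqS, ← hspan]
  congr 1
  exact e.symm.surjective.range_comp ((fun x : S => q x) ∘ a)

/-- The character by which an algebraic action operates on an eigenvector. -/
theorem IsAlgebraicAction.exists_character {ρ : Representation K (Torus K r) M}
    (hρ : IsAlgebraicAction ρ) {x : M} (hx0 : x ≠ 0)
    (hx : ∀ τ, ∃ c : K, ρ τ x = c • x) :
    ∃ χ : Torus K r →* K, IsRegularFunction χ ∧ ∀ τ, ρ τ x = χ τ • x := by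
  obtain ⟨f, hf⟩ : ∃ f : Module.Dual K M, f x ≠ 0 := by
    by_contra! h
    exact hx0 ((Module.forall_dual_apply_eq_zero_iff K x).1 h)
  choose c hc using hx
  -- The eigenvalue is a matrix coefficient normalized at x, which makes it regular;
  -- multiplicativity follows from x ≠ 0.
  have hfc : ∀ τ, c τ = ((f x)⁻¹ • f) (ρ τ x) := fun τ => by
    simp [hc, hf, mul_comm (c τ)]
  have hinj : ∀ {a b : K}, a • x = b • x → a = b := fun h => smul_left_injective K hx0 h
  refine ⟨⟨⟨c, hinj ?_⟩, fun σ τ => hinj ?_⟩, ?_, hc⟩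
  · rw [← hc, map_one, one_smul]; rfl
  · rw [← hc, map_mul, Module.End.mul_apply, hc τ, map_smul, hc σ, smul_smul, mul_comm]
  · have := hρ x ((f x)⁻¹ • f)
    simp only [← hfc] at this
    exact this

/-- The graded representation with a basis given by homogeneous eigenvectors of `M`. -/
theorem exists_gradedRep_of_eigenvectors {m : ℕ} (ℳ : (Fin m → ℤ) → Submodule K M)
    (ρ : Representation K (Torus K r) M) {s : ℕ} {y : Fin s → M} {deg : Fin s → Fin m → ℤ}
    (hdeg : ∀ j, y j ∈ ℳ (deg j)) {χ : Fin s → Torus K r →* K}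
    (hχ : ∀ j, IsRegularFunction (χ j)) (hρ : ∀ j τ, ρ τ (y j) = χ j τ • y j) :
    ∃ (V : GradedRep K r m) (e : V.V ≃ₗ[K] (Fin s → K)),
      (∀ d, ∀ x ∈ V.grading d, Fintype.linearCombination K y (e x) ∈ ℳ d) ∧
      ∀ τ x, Fintype.linearCombination K y (e (V.ρ τ x)) =
        ρ τ (Fintype.linearCombination K y (e x)) := by
  obtain ⟨V, e, hV, hVρ⟩ := GradedRep.exists_of_characters deg hχ
  refine ⟨V, e, fun d x hx => ?_, fun τ x => ?_⟩
  · rw [Fintype.linearCombination_apply]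
    refine sum_mem fun j _ => ?_
    by_cases hj : deg j = d
    · exact Submodule.smul_mem _ _ (hj ▸ hdeg j)
    · rw [hV d x hx j hj, zero_smul]
      exact zero_mem _
  · rw [Fintype.linearCombination_apply, Fintype.linearCombination_apply, map_sum]
    refine Finset.sum_congr rfl fun j _ => ?_
    rw [map_smul, hρ, smul_smul, hVρ, mul_comm]

end LinearAlgebra

/-! ### Equivariant minimal covers -/

section MinimalCover

variable {K : Type u} [Field K] {n m r : ℕ} {wt : Fin n → Fin m → ℤ}
  {ρA : Representation K (Torus K r) (PolyRing K n)}
  {M : Type v} [AddCommGroup M] [Module K M] [Module (PolyRing K n) M]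
  [IsScalarTower K (PolyRing K n) M] {ℳ : (Fin m → ℤ) → Submodule K M}
  {ρ : Representation K (Torus K r) M}

/-- A acts on M/𝔪M through constant terms, so generators over A already span over K. -/
theorem finite_quotient_irrelevantIdeal [Module.Finite (PolyRing K n) M] :
    Module.Finite K (M ⧸ irrelevantIdeal K n • (⊤ : Submodule (PolyRing K n) M)) := by
  obtain ⟨G, hG⟩ : (⊤ : Submodule (PolyRing K n)
      (M ⧸ irrelevantIdeal K n • (⊤ : Submodule (PolyRing K n) M))).FG := Module.Finite.fg_top
  refine ⟨⟨G, ?_⟩⟩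
  rw [Submodule.eq_top_iff']
  intro q
  have hq : q ∈ Submodule.span (PolyRing K n)
    (G : Set (M ⧸ irrelevantIdeal K n • (⊤ : Submodule (PolyRing K n) M))) := hG ▸ trivial
  induction hq using Submodule.closure_induction with
  | zero => exact zero_mem _
  | add x y _ _ hx hy => exact add_mem hx hy
  | smul_mem a q hq =>
    have : a • q = MvPolynomial.constantCoeff a • q := by
      rw [← algebraMap_smul (PolyRing K n) (MvPolynomial.constantCoeff a) q, ← sub_eq_zero,
        ← sub_smul]
      obtain ⟨x, rfl⟩ := Submodule.Quotient.mk_surjective _ q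
      rw [← Submodule.Quotient.mk_smul, Submodule.Quotient.mk_eq_zero]
      exact Submodule.smul_mem_smul (mem_irrelevantIdeal_iff.2 (by simp)) trivial
    rw [this]
    exact Submodule.smul_mem _ _ (Submodule.subset_span hq)

/-- Every finitely generated graded module with a compatible action is an equivariant quotient of
some `V ⊗ A` by a submodule of `𝔪 (V ⊗ A)`. -/
theorem IsCompatibleAction.exists_minimal_cover (hwt : IsPositiveGrading wt)
    (hM : IsFGGraded wt ℳ) (hρ : IsCompatibleAction ρA ℳ ρ) :
    ∃ (V : GradedRep K r m) (ε : V.Free n →ₗ[PolyRing K n] M),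
      PreservesDegree (V.freeGrading wt) ℳ ε ∧ IsEquivariant (V.freeAction ρA) ρ ε ∧
      Function.Surjective ε ∧
      LinearMap.ker ε ≤ irrelevantIdeal K n • (⊤ : Submodule (PolyRing K n) (V.Free n)) := by
  have := hM.finite
  have := finite_quotient_irrelevantIdeal (K := K) (n := n) (M := M)
  let q : M →ₗ[K] M ⧸ irrelevantIdeal K n • (⊤ : Submodule (PolyRing K n) M) :=
    (Submodule.mkQ (irrelevantIdeal K n • (⊤ : Submodule (PolyRing K n) M))).restrictScalars K
  have hqmk : ∀ x, q x = Submodule.Quotient.mk x := fun x => rfl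
  have hqsurj : Function.Surjective q := fun x => Submodule.Quotient.mk_surjective _ x
  -- Homogeneous eigenvectors lifting a basis of M/𝔪M: spanning will give surjectivity, independence
  -- the minimality.
  obtain ⟨s, y, hyS, hylin, hyspan⟩ := exists_basis_image_of_span_eq_top
    (hρ.span_homogeneous_eigenvectors hM hwt) q hqsurj
  choose deg hdeg using fun j => (hyS j).1
  choose χ hχ hχ' using fun j => hρ.algebraic.exists_character
    (fun h => hylin.ne_zero j (by simp only [Function.comp_apply, h, map_zero]))
    (hyS j).2
  obtain ⟨V, e, hdege, hequive⟩ := exists_gradedRep_of_eigenvectors ℳ ρ hdeg hχ hχ'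
  let φ : V.V →ₗ[K] M := Fintype.linearCombination K y ∘ₗ e.toLinearMap
  have hqφ : ∀ x : V.V, q (φ x) = Fintype.linearCombination K (q ∘ y) (e x) := by
    intro x
    simp only [φ, LinearMap.comp_apply, Fintype.linearCombination_apply, map_sum,
      Function.comp_apply, LinearEquiv.coe_coe]
    exact Finset.sum_congr rfl fun j _ => q.map_smul _ _
  have hφdeg : ∀ d, ∀ x ∈ V.grading d, φ x ∈ ℳ d := hdege
  have hφequiv : ∀ τ x, φ (V.ρ τ x) = ρ τ (φ x) := hequive
  let ε : V.Free n →ₗ[PolyRing K n] M := φ.liftBaseChange (PolyRing K n)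
  have hε : ∀ (b : PolyRing K n) (x : V.V), ε (b ⊗ₜ x) = b • φ x := fun b x =>
    LinearMap.liftBaseChange_tmul _ _ _ _
  have hdegε : PreservesDegree (V.freeGrading wt) ℳ ε := by
    intro d z hz
    induction hz using Submodule.span_induction with
    | zero => rw [map_zero]; exact zero_mem _
    | add x y _ _ hx hy => rw [map_add]; exact add_mem hx hy
    | smul c x _ hx =>
      rw [LinearMap.map_smul_of_tower]; exact Submodule.smul_mem _ _ hx
    | mem z hz =>
      obtain ⟨d', d'', rfl, b, hb, x, hx, rfl⟩ := hz
      rw [hε]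
      exact hM.smul_mem _ _ _ _ hb (hφdeg _ _ hx)
  refine ⟨V, ε, hdegε, ?_, ?_, ?_⟩
  · intro τ z
    induction z using TensorProduct.induction_on with
    | zero => simp
    | add x y hx hy => simp only [map_add, hx, hy]
    | tmul b x => rw [GradedRep.freeAction_tmul, hε, hε, hφequiv, hρ.map_smul]
  · rw [← LinearMap.range_eq_top]
    refine hM.eq_top_of_le_sup hwt
      (componentMap_mem_range hM (V.isFGGraded_freeGrading wt) hdegε) ?_
    · rw [Submodule.eq_top_iff']
      intro x
      have hx : q x ∈ Submodule.span K (Set.range (q ∘ y)) := hyspan ▸ trivial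
      rw [← Fintype.range_linearCombination K] at hx
      obtain ⟨c, hc⟩ := hx
      obtain ⟨c, rfl⟩ := e.surjective c
      have h1 : x - φ c ∈ irrelevantIdeal K n • (⊤ : Submodule (PolyRing K n) M) := by
        rw [← Submodule.Quotient.mk_eq_zero, ← hqmk, map_sub, hqφ, ← hc, sub_self]
      rw [← add_sub_cancel (φ c) x]
      exact Submodule.add_mem_sup ⟨1 ⊗ₜ c, by rw [hε, one_smul]⟩ h1
  · intro z hz
    -- Modulo 𝔪, z equals 1 ⊗ v with v its residue. From ε z = 0 it follows that φ v ∈ 𝔪M, and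
    -- independence of the classes of the y_j gives v = 0.
    have h1 := V.sub_residue_mem z
    have h2 : q (φ (V.residue n z)) = 0 := by
      have h3 : ε (z - 1 ⊗ₜ V.residue n z) ∈
          irrelevantIdeal K n • (⊤ : Submodule (PolyRing K n) M) := by
        have h4 := Submodule.mem_map_of_mem (f := ε) h1
        rw [Submodule.map_smul''] at h4
        exact Submodule.smul_mono le_rfl le_top h4
      rw [map_sub, LinearMap.mem_ker.1 hz, zero_sub, neg_mem_iff, hε, one_smul,
        ← Submodule.Quotient.mk_eq_zero, ← hqmk] at h3
      exact h3
    rw [hqφ] at h2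
    have h5 : V.residue n z = 0 :=
      e.map_eq_zero_iff.1
      (linearIndependent_iff_injective_fintypeLinearCombination.1 hylin (h2.trans (map_zero _).symm))
    rwa [h5, TensorProduct.tmul_zero, sub_zero] at h1

end MinimalCover

/-! ### Uniqueness of minimal covers and transport of actions -/

section Lifting

variable {K : Type u} [Field K] {n m r : ℕ} {wt : Fin n → Fin m → ℤ}
  {P : Type*} [AddCommGroup P] [Module K P] [Module (PolyRing K n) P]
  {𝒢 : (Fin m → ℤ) → Submodule K P}
  {F : Type*} [AddCommGroup F] [Module K F] [Module (PolyRing K n) F]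
  [IsScalarTower K (PolyRing K n) F] {ℱ : (Fin m → ℤ) → Submodule K F}

/-- Surjectivity of the composite gives F = im g + ker η, hence F = im g + 𝔪F, and graded Nakayama
applies. -/
theorem surjective_of_comp_surjective [IsScalarTower K (PolyRing K n) P] {M : Type*} [AddCommGroup M]
    [Module (PolyRing K n) M] (hwt : IsPositiveGrading wt) (hP : IsFGGraded wt 𝒢)
    (hF : IsFGGraded wt ℱ) {g : P →ₗ[PolyRing K n] F} (hg : PreservesDegree 𝒢 ℱ g)
    {η : F →ₗ[PolyRing K n] M} (hsurj : Function.Surjective (η ∘ₗ g))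
    (hker : LinearMap.ker η ≤ irrelevantIdeal K n • (⊤ : Submodule (PolyRing K n) F)) :
    Function.Surjective g := by
  rw [← LinearMap.range_eq_top]
  refine hF.eq_top_of_le_sup hwt (componentMap_mem_range hF hP hg) ?_
  · rw [Submodule.eq_top_iff']
    intro x
    obtain ⟨p, hp⟩ := hsurj (η x)
    rw [← add_sub_cancel (g p) x]
    refine Submodule.add_mem_sup ⟨p, rfl⟩ (hker ?_)
    rw [LinearMap.mem_ker, map_sub, sub_eq_zero, ← hp]
    rfl

variable {M : Type v} [AddCommGroup M] [Module K M] [Module (PolyRing K n) M]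
  [IsScalarTower K (PolyRing K n) M] {ℳ : (Fin m → ℤ) → Submodule K M}

/-- Graded free modules are graded projective. -/
theorem exists_lift_preservesDegree (hM : IsFGGraded wt ℳ) (hP : IsFGGraded wt 𝒢)
    (hF : IsFGGraded wt ℱ) {s : ℕ} (b : Module.Basis (Fin s) (PolyRing K n) P)
    (hb : ∀ j, ∃ e, b j ∈ 𝒢 e) {ε : P →ₗ[PolyRing K n] M} (hε : PreservesDegree 𝒢 ℳ ε)
    {η : F →ₗ[PolyRing K n] M} (hη : PreservesDegree ℱ ℳ η) (hsurj : Function.Surjective η) :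
    ∃ g : P →ₗ[PolyRing K n] F, PreservesDegree 𝒢 ℱ g ∧ η ∘ₗ g = ε := by
  choose e he using hb
  have hlift : ∀ j, ∃ y ∈ ℱ (e j), η y = ε (b j) := by
    intro j
    obtain ⟨y, hy⟩ := hsurj (ε (b j))
    refine ⟨componentMap hF.isInternal y (e j), componentMap_mem _ _ _, ?_⟩
    have := componentMap_map hF.isInternal hM.isInternal (η.restrictScalars K) hη y (e j)
    rw [LinearMap.restrictScalars_apply, LinearMap.restrictScalars_apply, hy,
      componentMap_of_mem _ (hε _ _ (he j)), Finsupp.single_eq_same] at this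
    exact this.symm
  choose y hy hy' using hlift
  let g := b.constr K y
  have hg : ∀ j, g (b j) = y j := fun j => b.constr_basis K y j
  refine ⟨g, fun d x hx => ?_, b.ext fun j => by rw [LinearMap.comp_apply, hg, hy']⟩
  -- The degree d part of a • b_j is a_{d − e_j} • b_j, and likewise for y_j, which has the same
  -- degree e_j; so g commutes with taking components.
  have hcomp : ∀ x, componentMap hF.isInternal (g x) d = g (componentMap hP.isInternal x d) := by
    intro x
    rw [← b.sum_repr x]
    simp only [map_sum, Finsupp.finsetSum_apply]
    refine Finset.sum_congr rfl fun j _ => ?_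
    have h1 := hP.componentMap_smul (he j) (b.repr x j) (d - e j)
    have h2 := hF.componentMap_smul (hy j) (b.repr x j) (d - e j)
    rw [sub_add_cancel] at h1 h2
    rw [h1, g.map_smul, g.map_smul, hg, h2]
  rw [mem_iff_componentMap_eq hP.isInternal] at hx
  rw [mem_iff_componentMap_eq hF.isInternal, hcomp, hx]

variable [IsScalarTower K (PolyRing K n) P]

/-- Two minimal graded free covers of the same module are isomorphic. -/
theorem exists_equiv_of_minimal_covers (hwt : IsPositiveGrading wt) (hM : IsFGGraded wt ℳ)
    (hP : IsFGGraded wt 𝒢) (hF : IsFGGraded wt ℱ)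
    {s : ℕ} (b : Module.Basis (Fin s) (PolyRing K n) P) (hb : ∀ j, ∃ e, b j ∈ 𝒢 e)
    {s' : ℕ} (b' : Module.Basis (Fin s') (PolyRing K n) F) (hb' : ∀ j, ∃ e, b' j ∈ ℱ e)
    {ε : P →ₗ[PolyRing K n] M} (hε : PreservesDegree 𝒢 ℳ ε) (hεsurj : Function.Surjective ε)
    (hεker : LinearMap.ker ε ≤ irrelevantIdeal K n • (⊤ : Submodule (PolyRing K n) P))
    {η : F →ₗ[PolyRing K n] M} (hη : PreservesDegree ℱ ℳ η) (hηsurj : Function.Surjective η)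
    (hηker : LinearMap.ker η ≤ irrelevantIdeal K n • (⊤ : Submodule (PolyRing K n) F)) :
    ∃ e : P ≃ₗ[PolyRing K n] F, PreservesDegree 𝒢 ℱ e ∧ PreservesDegree ℱ 𝒢 e.symm ∧
      ∀ x, η (e x) = ε x := by
  obtain ⟨g, hg, hgη⟩ := exists_lift_preservesDegree hM hP hF b hb hε hη hηsurj
  obtain ⟨h, hh, hhε⟩ := exists_lift_preservesDegree hM hF hP b' hb' hη hε hεsurj
  have hgs := surjective_of_comp_surjective hwt hP hF hg (hgη ▸ hεsurj) hηker
  have hhs := surjective_of_comp_surjective hwt hF hP hh (hhε ▸ hηsurj) hεker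
  have := hP.finite
  -- Both lifts are surjective, and a surjective endomorphism of a finitely generated module over a
  -- commutative ring is injective.
  have hinj : Function.Injective (h ∘ₗ g) :=
    OrzechProperty.injective_of_surjective_endomorphism _ (hhs.comp hgs)
  have hgi : Function.Injective g := Function.Injective.of_comp (f := h) hinj
  refine ⟨LinearEquiv.ofBijective g ⟨hgi, hgs⟩, hg, fun d x hx => ?_,
    fun x => LinearMap.congr_fun hgη x⟩
  obtain ⟨p, rfl⟩ := hgs x
  have hsymm : (LinearEquiv.ofBijective g ⟨hgi, hgs⟩).symm (g p) = p :=
    (LinearEquiv.ofBijective g ⟨hgi, hgs⟩).symm_apply_apply p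
  rw [hsymm, mem_iff_componentMap_eq hP.isInternal]
  apply hgi
  have := componentMap_map hP.isInternal hF.isInternal (g.restrictScalars K) hg p d
  rw [LinearMap.restrictScalars_apply, LinearMap.restrictScalars_apply] at this
  rw [← this]
  exact (mem_iff_componentMap_eq hF.isInternal).1 hx

/-- The action on a graded module lifts to every minimal graded free cover. -/
theorem exists_lift_action (hwt : IsPositiveGrading wt)
    {ρA : Representation K (Torus K r) (PolyRing K n)}
    (hA : IsCompatibleAction ρA (polyGrading K wt) ρA) (hM : IsFGGraded wt ℳ)
    {ρ : Representation K (Torus K r) M} (hρ : IsCompatibleAction ρA ℳ ρ)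
    (hF : IsFGGraded wt ℱ) {s : ℕ} (b : Module.Basis (Fin s) (PolyRing K n) F)
    (hb : ∀ j, ∃ e, b j ∈ ℱ e)
    {η : F →ₗ[PolyRing K n] M} (hη : PreservesDegree ℱ ℳ η) (hηsurj : Function.Surjective η)
    (hηker : LinearMap.ker η ≤ irrelevantIdeal K n • (⊤ : Submodule (PolyRing K n) F)) :
    ∃ ρF : Representation K (Torus K r) F, IsCompatibleAction ρA ℱ ρF ∧
      IsEquivariantlyFree wt ρA ℱ ρF ∧ IsEquivariant ρF ρ η := by
  obtain ⟨V, ε, hε, hεequiv, hεsurj, hεker⟩ := hρ.exists_minimal_cover hwt hM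
  obtain ⟨t, c, hc⟩ := V.exists_homogeneous_basis wt
  obtain ⟨e, he, he', heη⟩ := exists_equiv_of_minimal_covers hwt hM (V.isFGGraded_freeGrading wt)
    hF c hc b hb hε hεsurj hεker hη hηsurj hηker
  have hV := V.isCompatibleAction_freeAction hA
  let e' : V.Free n ≃ₗ[K] F := e.restrictScalars K
  -- The action of V ⊗ A is transported along e; equivariance of η then follows from η ∘ e = ε.
  let ρF : Representation K (Torus K r) F :=
    { toFun τ := e'.conj (V.freeAction ρA τ)
      map_one' := by rw [map_one]; exact e'.conj_id
      map_mul' σ τ := by rw [map_mul]; exact e'.conj_comp _ _ }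
  have hρF : ∀ τ x, ρF τ x = e (V.freeAction ρA τ (e.symm x)) := fun τ x => rfl
  refine ⟨ρF, ⟨fun x f => ?_, fun τ d x hx => ?_, fun τ a x => ?_⟩, ⟨V, e, he, he', ?_⟩, ?_⟩
  · exact hV.algebraic (e.symm x) (f ∘ₗ e'.toLinearMap)
  · rw [hρF]
    exact he _ _ (hV.map_mem _ _ _ (he' _ _ hx))
  · rw [hρF, hρF, e.symm.map_smul, hV.map_smul, e.map_smul]
  · intro τ x
    rw [hρF, e.symm_apply_apply]
  · intro τ x
    rw [hρF, heη, hεequiv, ← heη, e.apply_symm_apply]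

end Lifting

/-! ### Minimal resolutions have length at most n -/

section Length

variable {K : Type u} [Field K] {n : ℕ}

/-- The ideal generated by the first `k` variables. -/
noncomputable def initialIdeal (K : Type u) [Field K] (n k : ℕ) : Ideal (PolyRing K n) :=
  Ideal.span (MvPolynomial.X '' {i | i.val < k})

theorem initialIdeal_zero : initialIdeal K n 0 = ⊥ := by
  simp [initialIdeal]

theorem initialIdeal_self : initialIdeal K n n = irrelevantIdeal K n := by
  rw [initialIdeal, irrelevantIdeal, ← Set.image_univ]
  congr 2
  ext i
  simp

theorem initialIdeal_succ {k : ℕ} (hk : k < n) :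
    initialIdeal K n (k + 1) = initialIdeal K n k ⊔ Ideal.span {MvPolynomial.X ⟨k, hk⟩} := by
  rw [initialIdeal, initialIdeal, ← Ideal.span_union, ← Set.image_singleton, ← Set.image_union]
  congr 2
  ext i
  simp only [Set.mem_ofPred_eq, Set.mem_union, Set.mem_singleton_iff, Fin.ext_iff]
  omega

/-- The variables form a regular sequence. -/
theorem mem_initialIdeal_of_X_mul_mem {k : ℕ} (hk : k < n) {a : PolyRing K n}
    (ha : MvPolynomial.X ⟨k, hk⟩ * a ∈ initialIdeal K n k) : a ∈ initialIdeal K n k := by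
  rw [initialIdeal, MvPolynomial.mem_ideal_span_X_image] at ha ⊢
  -- The ideal is monomial, so membership is tested monomial by monomial; multiplication by x_{k+1}
  -- leaves the exponents of the first k variables unchanged.
  intro s hs
  obtain ⟨i, hi, his⟩ := ha (Finsupp.single ⟨k, hk⟩ 1 + s) (by
    rw [MvPolynomial.mem_support_iff, MvPolynomial.coeff_X_mul]
    exact MvPolynomial.mem_support_iff.1 hs)
  refine ⟨i, hi, ?_⟩
  rwa [Finsupp.add_apply, Finsupp.single_eq_of_ne, zero_add] at his
  rintro rfl
  exact lt_irrefl k hi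

theorem mem_smul_top_iff_repr_mem {R : Type*} [CommRing R] {P : Type*} [AddCommGroup P]
    [Module R P] {s : ℕ} (b : Module.Basis (Fin s) R P) (I : Ideal R) {x : P} :
    x ∈ I • (⊤ : Submodule R P) ↔ ∀ j, b.repr x j ∈ I := by
  constructor
  · intro hx j
    induction hx using Submodule.smul_induction_on' with
    | smul a ha y _ => simpa using I.mul_mem_right _ ha
    | add x _ y _ hx hy => simpa using add_mem hx hy
  · intro h
    rw [← b.sum_repr x]
    exact sum_mem fun j _ => Submodule.smul_mem_smul (h j) trivial

variable {F : ℕ → Type w} [∀ i, AddCommGroup (F i)] [∀ i, Module (PolyRing K n) (F i)]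
  {d : ∀ i, F (i + 1) →ₗ[PolyRing K n] F i}

/-- A free resolution stays exact in degrees greater than `k` after the first `k` variables are
set to zero. -/
theorem exists_sub_mem_initialIdeal_smul
    (hfree : ∀ i, ∃ s, Nonempty (Module.Basis (Fin s) (PolyRing K n) (F i)))
    (hd : ∀ i, Function.Exact (d (i + 1)) (d i)) {k : ℕ} (hk : k ≤ n) :
    ∀ i, k ≤ i → ∀ z : F (i + 1),
      d i z ∈ initialIdeal K n k • (⊤ : Submodule (PolyRing K n) (F i)) →
      ∃ y : F (i + 2), z - d (i + 1) y ∈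
        initialIdeal K n k • (⊤ : Submodule (PolyRing K n) (F (i + 1))) := by
  induction k with
  | zero =>
    intro i _ z hz
    rw [initialIdeal_zero, Submodule.bot_smul, Submodule.mem_bot] at hz
    obtain ⟨y, rfl⟩ := (hd i z).1 hz
    exact ⟨y, by rw [sub_self]; exact zero_mem _⟩
  | succ k ih =>
    intro i hi z hz
    obtain ⟨j, rfl⟩ : ∃ j, i = j + 1 := ⟨i - 1, by omega⟩
    have ih' := ih (by omega)
    let X : PolyRing K n := MvPolynomial.X ⟨k, hk⟩
    have hsup : ∀ {P : Type w} [AddCommGroup P] [Module (PolyRing K n) P],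
        initialIdeal K n (k + 1) • (⊤ : Submodule (PolyRing K n) P) =
          initialIdeal K n k • ⊤ ⊔ Ideal.span {X} • ⊤ := by
      intro P _ _
      rw [initialIdeal_succ hk, Submodule.sup_smul]
    rw [hsup, Submodule.mem_sup] at hz
    obtain ⟨c, hc, x, hx, hcx⟩ := hz
    rw [Submodule.ideal_span_singleton_smul] at hx
    obtain ⟨y, -, rfl⟩ := hx
    replace hcx : c + X • y = d (j + 1) z := hcx
    have hmap : ∀ (l : ℕ) {p : F (l + 1)},
        p ∈ initialIdeal K n k • (⊤ : Submodule (PolyRing K n) (F (l + 1))) →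
        d l p ∈ initialIdeal K n k • (⊤ : Submodule (PolyRing K n) (F l)) := by
      intro l p hp
      have h1 := Submodule.mem_map_of_mem (f := d l) hp
      rw [Submodule.map_smul''] at h1
      exact Submodule.smul_mono le_rfl le_top h1
    -- Applying d once more to c + X y = d z shows X • d y ∈ I_k F_j; F_j is free and X is regular
    -- modulo I_k.
    have hy : d j y ∈ initialIdeal K n k • (⊤ : Submodule (PolyRing K n) (F j)) := by
      have h1 : X • d j y ∈ initialIdeal K n k • (⊤ : Submodule (PolyRing K n) (F j)) := by
        have h2 : d j (c + X • y) = 0 := by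
          rw [hcx]
          exact (hd j).apply_apply_eq_zero z
        rw [map_add, map_smul] at h2
        rw [eq_neg_of_add_eq_zero_right h2]
        exact neg_mem (hmap j hc)
      obtain ⟨s, ⟨b⟩⟩ := hfree j
      rw [mem_smul_top_iff_repr_mem b] at h1 ⊢
      intro t
      have h3 := h1 t
      rw [map_smul, Finsupp.smul_apply, smul_eq_mul] at h3
      exact mem_initialIdeal_of_X_mul_mem hk h3
    -- The induction hypothesis is used twice: in degree j it makes y a boundary d p modulo I_k, so
    -- z − X p is a cycle modulo I_k; in degree j + 1 it makes this cycle a boundary. The lower use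
    -- costs one degree per variable.
    obtain ⟨p, hp⟩ := ih' j (by omega) y hy
    obtain ⟨q, hq⟩ := ih' (j + 1) (by omega) (z - X • p) (by
      have : d (j + 1) (z - X • p) = c + X • (y - d (j + 1) p) := by
        rw [map_sub, map_smul, ← hcx, smul_sub, add_sub_assoc]
      rw [this]
      exact add_mem hc (Submodule.smul_mem _ _ hp))
    refine ⟨q, ?_⟩
    rw [hsup, show z - d (j + 1 + 1) q = (z - X • p - d (j + 1 + 1) q) + X • p by abel]
    exact Submodule.add_mem_sup hq
      (Submodule.smul_mem_smul (Ideal.mem_span_singleton_self X) trivial)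

/-- A minimal free resolution over a polynomial ring in `n` variables has length at most `n`. -/
theorem irrelevantIdeal_smul_top_eq_top
    (hfree : ∀ i, ∃ s, Nonempty (Module.Basis (Fin s) (PolyRing K n) (F i)))
    (hd : ∀ i, Function.Exact (d (i + 1)) (d i))
    (hmin : ∀ i, LinearMap.range (d i) ≤
      irrelevantIdeal K n • (⊤ : Submodule (PolyRing K n) (F i))) {i : ℕ} (hi : n < i) :
    irrelevantIdeal K n • (⊤ : Submodule (PolyRing K n) (F i)) = ⊤ := by
  obtain ⟨j, rfl⟩ : ∃ j, i = j + 1 := ⟨i - 1, by omega⟩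
  rw [Submodule.eq_top_iff']
  intro z
  obtain ⟨y, hy⟩ := exists_sub_mem_initialIdeal_smul hfree hd le_rfl j (by omega) z
    (by rw [initialIdeal_self]; exact hmin j ⟨z, rfl⟩)
  rw [initialIdeal_self] at hy
  rw [← sub_add_cancel z (d (j + 1) y)]
  exact add_mem hy (hmin (j + 1) ⟨y, rfl⟩)

end Length

/-! ### Assembling the resolution and the actions -/

section Resolutions

variable {K : Type u} [Field K] {n m r : ℕ} {wt : Fin n → Fin m → ℤ}
  {ρA : Representation K (Torus K r) (PolyRing K n)}
  {M : Type v} [AddCommGroup M] [Module K M] [Module (PolyRing K n) M]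
  {ℳ : (Fin m → ℤ) → Submodule K M} {ρ : Representation K (Torus K r) M}

theorem IsMinimalFreeResolution.subsingleton {V : ℕ → GradedRep K r m}
    {d : ∀ i, (V (i + 1)).Free n →ₗ[PolyRing K n] (V i).Free n}
    {ε : (V 0).Free n →ₗ[PolyRing K n] M}
    (h : IsMinimalFreeResolution wt ℳ (fun i => (V i).freeGrading wt) d ε) {i : ℕ} (hi : n < i) :
    Subsingleton (V i).V := by
  have htop := irrelevantIdeal_smul_top_eq_top
    (fun i => (h.free i).imp fun s hs => ⟨hs.choose⟩) h.exact_succ h.minimal hi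
  refine subsingleton_of_forall_eq 0 fun x => ?_
  have hx : (1 ⊗ₜ x : (V i).Free n) ∈
      irrelevantIdeal K n • (⊤ : Submodule (PolyRing K n) ((V i).Free n)) := by
    rw [htop]; trivial
  simpa [GradedRep.residue_tmul] using (V i).residue_eq_zero hx

variable [IsScalarTower K (PolyRing K n) M]

/-- A homogeneous and stable submodule of `𝔪 (V ⊗ A)` for a graded representation `V`. -/
structure Syzygy (wt : Fin n → Fin m → ℤ) (ρA : Representation K (Torus K r) (PolyRing K n)) where
  V : GradedRep K r m
  N : Submodule (PolyRing K n) (V.Free n)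
  homogeneous : ∀ x ∈ N, ∀ d, componentMap (V.isInternal_freeGrading wt) x d ∈ N
  stable : ∀ τ, ∀ x ∈ N, V.freeAction ρA τ x ∈ N
  minimal : N ≤ irrelevantIdeal K n • (⊤ : Submodule (PolyRing K n) (V.Free n))

theorem IsCompatibleAction.exists_syzygy (hwt : IsPositiveGrading wt)
    (hM : IsFGGraded wt ℳ) (hρ : IsCompatibleAction ρA ℳ ρ) :
    ∃ (S : Syzygy wt ρA) (ε : S.V.Free n →ₗ[PolyRing K n] M),
      PreservesDegree (S.V.freeGrading wt) ℳ ε ∧ IsEquivariant (S.V.freeAction ρA) ρ ε ∧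
      Function.Surjective ε ∧ LinearMap.ker ε = S.N := by
  obtain ⟨V, ε, hε, hεequiv, hεsurj, hεker⟩ := hρ.exists_minimal_cover hwt hM
  exact ⟨⟨V, LinearMap.ker ε, componentMap_mem_ker hM (V.isFGGraded_freeGrading wt) hε,
    hεequiv.map_mem_ker, hεker⟩, ε, hε, hεequiv, hεsurj, rfl⟩

/-- Covering N and composing with its inclusion changes neither image nor kernel. The data of a
`Syzygy` are exactly what is needed to repeat this step. -/
theorem Syzygy.exists_next (hwt : IsPositiveGrading wt)
    (hA : IsCompatibleAction ρA (polyGrading K wt) ρA) (S : Syzygy wt ρA) :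
    ∃ (S' : Syzygy wt ρA) (f : S'.V.Free n →ₗ[PolyRing K n] S.V.Free n),
      PreservesDegree (S'.V.freeGrading wt) (S.V.freeGrading wt) f ∧
      IsEquivariant (S'.V.freeAction ρA) (S.V.freeAction ρA) f ∧
      LinearMap.range f = S.N ∧ LinearMap.ker f = S'.N := by
  obtain ⟨S', ε, hε, hεequiv, hεsurj, hεker⟩ :=
    ((S.V.isCompatibleAction_freeAction hA).submodule S.stable).exists_syzygy hwt
      ((S.V.isFGGraded_freeGrading wt).submodule S.homogeneous)
  let ε' : S'.V.Free n →ₗ[PolyRing K n] S.N := ε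
  refine ⟨S', S.N.subtype ∘ₗ ε', fun d x hx => hε d x hx,
    fun τ x => congrArg Subtype.val (hεequiv τ x), ?_, ?_⟩
  · have hε' : LinearMap.range ε' = ⊤ := LinearMap.range_eq_top.2 hεsurj
    rw [LinearMap.range_comp_of_range_eq_top _ hε', Submodule.range_subtype]
  · rw [LinearMap.ker_comp_of_ker_eq_bot _ (Submodule.ker_subtype _)]
    exact hεker

theorem exists_equivariant_resolution (hwt : IsPositiveGrading wt)
    (hA : IsCompatibleAction ρA (polyGrading K wt) ρA) (hM : IsFGGraded wt ℳ)
    (hρ : IsCompatibleAction ρA ℳ ρ) :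
    ∃ (V : ℕ → GradedRep K r m)
        (d : ∀ i, (V (i + 1)).Free n →ₗ[PolyRing K n] (V i).Free n)
        (ε : (V 0).Free n →ₗ[PolyRing K n] M),
      IsMinimalFreeResolution wt ℳ (fun i => (V i).freeGrading wt) d ε ∧
      (∀ i, IsEquivariant ((V (i + 1)).freeAction ρA) ((V i).freeAction ρA) (d i)) ∧
      IsEquivariant ((V 0).freeAction ρA) ρ ε := by
  obtain ⟨S, ε, hε, hεequiv, hεsurj, hεker⟩ := hρ.exists_syzygy hwt hM
  choose next f hfdeg hfequiv hfrange hfker using Syzygy.exists_next (r := r) hwt hA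
  let seq : ℕ → Syzygy wt ρA := fun i => Nat.rec S (fun _ => next) i
  refine ⟨fun i => (seq i).V, fun i => f (seq i), ε, ?_, fun i => hfequiv (seq i), hεequiv⟩
  exact
    { graded := fun i => (seq i).V.isFGGraded_freeGrading wt
      free := fun i => (seq i).V.exists_homogeneous_basis wt
      d_degree := fun i => hfdeg (seq i)
      ε_degree := hε
      ε_surjective := hεsurj
      exact_zero := LinearMap.exact_iff.2 (hεker.trans (hfrange S).symm)
      exact_succ := fun i => LinearMap.exact_iff.2
        ((hfker (seq i)).trans (hfrange (seq (i + 1))).symm)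
      minimal := fun i => (hfrange (seq i)).trans_le (seq i).minimal }

theorem IsMinimalFreeResolution.exists_action (hwt : IsPositiveGrading wt)
    (hA : IsCompatibleAction ρA (polyGrading K wt) ρA) (hM : IsFGGraded wt ℳ)
    (hρ : IsCompatibleAction ρA ℳ ρ)
    {F : ℕ → Type w} [∀ i, AddCommGroup (F i)] [∀ i, Module K (F i)]
    [∀ i, Module (PolyRing K n) (F i)] [∀ i, IsScalarTower K (PolyRing K n) (F i)]
    {ℱ : ∀ i, (Fin m → ℤ) → Submodule K (F i)}
    {d : ∀ i, F (i + 1) →ₗ[PolyRing K n] F i} {ε : F 0 →ₗ[PolyRing K n] M}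
    (h : IsMinimalFreeResolution wt ℳ ℱ d ε) :
    ∃ ρF : ∀ i, Representation K (Torus K r) (F i),
      (∀ i, IsCompatibleAction ρA (ℱ i) (ρF i)) ∧
      (∀ i, IsEquivariantlyFree wt ρA (ℱ i) (ρF i)) ∧
      (∀ i, IsEquivariant (ρF (i + 1)) (ρF i) (d i)) ∧
      IsEquivariant (ρF 0) ρ ε := by
  have hker0 : LinearMap.ker ε = LinearMap.range (d 0) := LinearMap.exact_iff.1 h.exact_zero
  have hker : ∀ i, LinearMap.ker (d i) = LinearMap.range (d (i + 1)) := fun i =>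
    LinearMap.exact_iff.1 (h.exact_succ i)
  -- Stability of the image of d_i is carried along: it lets the action restrict to the module that
  -- F_{i+1} covers.
  let Q : ℕ → Type _ := fun i => { σ : Representation K (Torus K r) (F i) //
    IsCompatibleAction ρA (ℱ i) σ ∧ IsEquivariantlyFree wt ρA (ℱ i) σ ∧
      ∀ τ, ∀ x ∈ LinearMap.range (d i), σ τ x ∈ LinearMap.range (d i) }
  have hzero : ∃ σ : Q 0, IsEquivariant σ.1 ρ ε := by
    obtain ⟨s, b, hb⟩ := h.free 0
    obtain ⟨σ, h1, h2, h3⟩ := exists_lift_action hwt hA hM hρ (h.graded 0) b hb h.ε_degree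
      h.ε_surjective (hker0 ▸ h.minimal 0)
    exact ⟨⟨σ, h1, h2, hker0 ▸ h3.map_mem_ker⟩, h3⟩
  have hsucc : ∀ i (σ : Q i), ∃ σ' : Q (i + 1), IsEquivariant σ'.1 σ.1 (d i) := by
    rintro i ⟨σ, h1, -, h3⟩
    obtain ⟨s, b, hb⟩ := h.free (i + 1)
    -- The codomain is written with restricted scalars to match the gradings and actions on
    -- submodules.
    let η : F (i + 1) →ₗ[PolyRing K n] (LinearMap.range (d i)).restrictScalars K :=
      (d i).rangeRestrict
    have hη : LinearMap.ker η = LinearMap.range (d (i + 1)) :=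
      (LinearMap.ker_rangeRestrict (d i)).trans (hker i)
    obtain ⟨σ', h1', h2', h3'⟩ := exists_lift_action hwt hA
      ((h.graded i).submodule (componentMap_mem_range (h.graded i) (h.graded (i + 1))
        (h.d_degree i))) (h1.submodule h3) (h.graded (i + 1)) b hb (η := η) (h.d_degree i)
      (LinearMap.surjective_rangeRestrict (d i)) (hη ▸ h.minimal (i + 1))
    exact ⟨⟨σ', h1', h2', hη ▸ h3'.map_mem_ker⟩, fun τ x => congrArg Subtype.val (h3' τ x)⟩
  obtain ⟨σ₀, hσ₀⟩ := hzero
  choose next hnext using hsucc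
  let seq : ∀ i, Q i := fun i => Nat.rec σ₀ next i
  exact ⟨fun i => (seq i).1, fun i => (seq i).2.1, fun i => (seq i).2.2.1,
    fun i => hnext i (seq i), hσ₀⟩

end Resolutions

end EquivariantResolution

theorem proposition2p13 {K : Type*} [Field K] {n m r : ℕ}
    (wt : Fin n → Fin m → ℤ) (hwt : IsPositiveGrading wt)
    (ρA : Representation K (Torus K r) (PolyRing K n))
    (hA : IsCompatibleAction ρA (polyGrading K wt) ρA)
    {M : Type*} [AddCommGroup M] [Module K M] [Module (PolyRing K n) M] [IsScalarTower K (PolyRing K n) M]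
    (ℳ : (Fin m → ℤ) → Submodule K M) (hM : IsFGGraded wt ℳ)
    (ρM : Representation K (Torus K r) M) (hρM : IsCompatibleAction ρA ℳ ρM) :
    (∃ (V : ℕ → GradedRep K r m)
        (d : ∀ i, (V (i + 1)).Free n →ₗ[PolyRing K n] (V i).Free n)
        (ε : (V 0).Free n →ₗ[PolyRing K n] M),
      IsMinimalFreeResolution wt ℳ (fun i => (V i).freeGrading wt) d ε ∧
      (∀ i, IsCompatibleAction ρA ((V i).freeGrading wt) ((V i).freeAction ρA)) ∧
      (∀ i, IsEquivariant ((V (i + 1)).freeAction ρA) ((V i).freeAction ρA) (d i)) ∧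
      IsEquivariant ((V 0).freeAction ρA) ρM ε ∧
      ∀ i, n < i → Subsingleton ((V i).V)) ∧
    (∀ (F : ℕ → Type*) [∀ i, AddCommGroup (F i)] [∀ i, Module K (F i)]
        [∀ i, Module (PolyRing K n) (F i)] [∀ i, IsScalarTower K (PolyRing K n) (F i)]
        (ℱ : ∀ i, (Fin m → ℤ) → Submodule K (F i))
        (d : ∀ i, F (i + 1) →ₗ[PolyRing K n] F i) (ε : F 0 →ₗ[PolyRing K n] M),
      IsMinimalFreeResolution wt ℳ ℱ d ε →
      ∃ ρF : ∀ i, Representation K (Torus K r) (F i),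
        (∀ i, IsCompatibleAction ρA (ℱ i) (ρF i)) ∧
        (∀ i, IsEquivariantlyFree wt ρA (ℱ i) (ρF i)) ∧
        (∀ i, IsEquivariant (ρF (i + 1)) (ρF i) (d i)) ∧
        IsEquivariant (ρF 0) ρM ε) := by
  refine ⟨?_, fun F _ _ _ _ ℱ d ε h => h.exists_action hwt hA hM hρM⟩
  obtain ⟨V, d, ε, h, hd, hε⟩ := exists_equivariant_resolution hwt hA hM hρM
  exact ⟨V, d, ε, h, fun i => (V i).isCompatibleAction_freeAction hA, hd, hε,
    fun i hi => h.subsingleton hi⟩
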